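/- Work in the language $L_2$ of second order arithmetic: the two-sorted first order language with number variables $x_0,x_1,\dots$ and set variables $X_0,X_1,\dots$, non-logical symbols $0,1,+,\times,<$ and $\in$, and equality on the number sort. Provability $\vdash$ is provability in classical two-sorted first order logic with equality. A formula is arithmetical if it has no set quantifiers (free set variables are allowed); it is $\Sigma^0_1$ (respectively $\Pi^0_1$) if it is of the form $\exists k\,\theta$ (respectively $\forall k\,\theta$), where $k$ is a number variable and all quantifiers of $\theta$ are bounded number quantifiers. The axioms of $\mathsf{RCA}_0$ are the axioms of $\mathsf{PA}^-$ (the axioms for the nonnegative part of a discretely ordered ring) together with the universal closures of all formulas $$\bigl(\varphi(0)\wedge\forall n(\varphi(n)\rightarrow\varphi(n+1))\bigr)\rightarrow\forall n\,\varphi(n)\qquad(\varphi\ \Sigma^0_1)$$ and $$\forall n(\varphi(n)\leftrightarrow\psi(n))\rightarrow\exists X\forall n(n\in X\leftrightarrow\varphi(n))\qquad(\varphi\ \Sigma^0_1,\ \psi\ \Pi^0_1,\ X\text{ not free in }\varphi),$$ where $\varphi$ and $\psi$ may contain further free number and set variables. The arithmetical comprehension scheme is the set of the universal closures of all formulas $\exists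 X\forall n(n\in X\leftrightarrow\varphi(n))$ with $\varphi$ arithmetical, $X$ not free in $\varphi$, and possibly further free number and set variables in $\varphi$. Weak König's lemma, $\mathrm{WKL}$, is the $L_2$-sentence stating that every infinite subtree of the full binary tree $2^{<\mathbb N}$ (a set of codes of finite binary strings that is closed under initial segments) has an infinite path. **Theorem.** No subset of the arithmetical comprehension scheme is equivalent over $\mathsf{RCA}_0$ to weak König's lemma. That is, there is no set $S$ of instances of the arithmetical comprehension scheme such that both $\mathsf{RCA}_0\cup S\vdash\mathrm{WKL}$ and $\mathsf{RCA}_0\cup\{\mathrm{WKL}\}\vdash\sigma$ for every $\sigma\in S$. -/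

import Mathlib

namespace SecondOrderArithmetic

/-! ## The language of second order arithmetic

Formulas are well scoped: `Formula n m` is the type of formulas whose free variables are among
`n` number variables and `m` set variables. A quantifier binds the variable with index `0` of its
sort, and the other indices of that sort go up by one inside its scope. -/

/-- Number terms in `n` number variables, built from `0`, `1`, `+` and `*`. -/
inductive Term (n : ℕ) : Type
  | var (i : Fin n) : Term n
  | zero : Term n
  | one : Term n
  | add (t u : Term n) : Term n
  | mul (t u : Term n) : Term n

/-- Formulas with `n` free number variables and `m` free set variables. Equality is a symbol of
the number sort only; the remaining connectives and quantifiers are the usual classical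
abbreviations. -/
inductive Formula : ℕ → ℕ → Type
  | eq {n m : ℕ} (t u : Term n) : Formula n m
  | lt {n m : ℕ} (t u : Term n) : Formula n m
  | mem {n m : ℕ} (t : Term n) (X : Fin m) : Formula n m
  | falsum {n m : ℕ} : Formula n m
  | imp {n m : ℕ} (φ ψ : Formula n m) : Formula n m
  | all {n m : ℕ} (φ : Formula (n + 1) m) : Formula n m
  | allSet {n m : ℕ} (φ : Formula n (m + 1)) : Formula n m

/-- A sentence is a formula without free variables. -/
abbrev Sentence : Type := Formula 0 0

namespace Term

/-- Simultaneous substitution of terms for the variables of a term. -/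
def subst {n k : ℕ} (s : Fin n → Term k) : Term n → Term k
  | var i => s i
  | zero => zero
  | one => one
  | add t u => add (t.subst s) (u.subst s)
  | mul t u => mul (t.subst s) (u.subst s)

/-- Weakening: the term in a context with a new number variable of index `0`. -/
def shift {n : ℕ} (t : Term n) : Term (n + 1) := t.subst fun i => var i.succ

/-- The pairing function `(x, y) ↦ (x + y)² + x`. -/
def pair {n : ℕ} (t u : Term n) : Term n := add (mul (add t u) (add t u)) t

/-- The triple `(x, (y, z))`. -/
def triple {n : ℕ} (t u v : Term n) : Term n := pair t (pair u v)

end Term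

namespace Formula

def neg {n m : ℕ} (φ : Formula n m) : Formula n m := imp φ falsum

def and {n m : ℕ} (φ ψ : Formula n m) : Formula n m := neg (imp φ (neg ψ))

def or {n m : ℕ} (φ ψ : Formula n m) : Formula n m := imp (neg φ) ψ

def iff {n m : ℕ} (φ ψ : Formula n m) : Formula n m := and (imp φ ψ) (imp ψ φ)

def ex {n m : ℕ} (φ : Formula (n + 1) m) : Formula n m := neg (all (neg φ))

def exSet {n m : ℕ} (φ : Formula n (m + 1)) : Formula n m := neg (allSet (neg φ))

/-- `t ≤ u` -/
def le {n m : ℕ} (t u : Term n) : Formula n m := or (lt t u) (eq t u)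

/-- `∀ x < t, φ`, where the variable `x` does not occur in `t`. -/
def ball {n m : ℕ} (t : Term n) (φ : Formula (n + 1) m) : Formula n m :=
  all (imp (lt (.var 0) t.shift) φ)

/-- `∃ x < t, φ`, where the variable `x` does not occur in `t`. -/
def bex {n m : ℕ} (t : Term n) (φ : Formula (n + 1) m) : Formula n m :=
  ex (and (lt (.var 0) t.shift) φ)

/-- Simultaneous capture-avoiding substitution of number terms for the free number variables and
of set variables for the free set variables. -/
def subst : {n m k l : ℕ} → (Fin n → Term k) → (Fin m → Fin l) → Formula n m → Formula k l
  | _, _, _, _, s, _, eq t u => eq (t.subst s) (u.subst s)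
  | _, _, _, _, s, _, lt t u => lt (t.subst s) (u.subst s)
  | _, _, _, _, s, r, mem t X => mem (t.subst s) (r X)
  | _, _, _, _, _, _, falsum => falsum
  | _, _, _, _, s, r, imp φ ψ => imp (φ.subst s r) (ψ.subst s r)
  | _, _, _, _, s, r, all φ => all (φ.subst (Fin.cons (.var 0) fun i => (s i).shift) r)
  | _, _, _, _, s, r, allSet φ => allSet (φ.subst s (Fin.cons 0 fun i => (r i).succ))

/-- Weakening by a new number variable of index `0`. -/
def shiftNum {n m : ℕ} (φ : Formula n m) : Formula (n + 1) m := φ.subst (fun i => .var i.succ) id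

/-- Weakening by a new set variable of index `0`. -/
def shiftSet {n m : ℕ} (φ : Formula n m) : Formula n (m + 1) := φ.subst .var Fin.succ

/-- `φ(t)`: the term `t` for the number variable of index `0`. -/
def instNum {n m : ℕ} (φ : Formula (n + 1) m) (t : Term n) : Formula n m :=
  φ.subst (Fin.cons t .var) id

/-- `φ(X)`: the set variable `X` for the set variable of index `0`. -/
def instSet {n m : ℕ} (φ : Formula n (m + 1)) (X : Fin m) : Formula n m :=
  φ.subst .var (Fin.cons X id)

/-- Universal quantification over all free set variables. -/
def closeSets {n : ℕ} : {m : ℕ} → Formula n m → Formula n 0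
  | 0, φ => φ
  | _ + 1, φ => closeSets (allSet φ)

/-- Universal quantification over all free number variables. -/
def closeNums : {n : ℕ} → Formula n 0 → Sentence
  | 0, φ => φ
  | _ + 1, φ => closeNums (all φ)

/-- The universal closure of a formula. -/
def closure {n m : ℕ} (φ : Formula n m) : Sentence := closeNums (closeSets φ)

/-! ### Classes of formulas -/

/-- Arithmetical formulas: no set quantifiers (free set variables are allowed). -/
def IsArithmetical : {n m : ℕ} → Formula n m → Prop
  | _, _, eq _ _ => True
  | _, _, lt _ _ => True
  | _, _, mem _ _ => True
  | _, _, falsum => True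
  | _, _, imp φ ψ => φ.IsArithmetical ∧ ψ.IsArithmetical
  | _, _, all φ => φ.IsArithmetical
  | _, _, allSet _ => False

/-- Bounded formulas: all quantifiers are bounded number quantifiers. -/
inductive IsBounded : {n m : ℕ} → Formula n m → Prop
  | eq {n m : ℕ} (t u : Term n) : IsBounded (Formula.eq (m := m) t u)
  | lt {n m : ℕ} (t u : Term n) : IsBounded (Formula.lt (m := m) t u)
  | mem {n m : ℕ} (t : Term n) (X : Fin m) : IsBounded (Formula.mem t X)
  | falsum {n m : ℕ} : IsBounded (Formula.falsum : Formula n m)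
  | imp {n m : ℕ} {φ ψ : Formula n m} : IsBounded φ → IsBounded ψ → IsBounded (Formula.imp φ ψ)
  | ball {n m : ℕ} (t : Term n) {φ : Formula (n + 1) m} : IsBounded φ → IsBounded (Formula.ball t φ)
  | bex {n m : ℕ} (t : Term n) {φ : Formula (n + 1) m} : IsBounded φ → IsBounded (Formula.bex t φ)

/-- `Σ⁰₁` formulas `∃ k, θ` with `θ` bounded. -/
def IsSigma01 {n m : ℕ} (φ : Formula n m) : Prop :=
  ∃ θ : Formula (n + 1) m, θ.IsBounded ∧ φ = ex θ

/-- `Π⁰₁` formulas `∀ k, θ` with `θ` bounded. -/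
def IsPi01 {n m : ℕ} (φ : Formula n m) : Prop :=
  ∃ θ : Formula (n + 1) m, θ.IsBounded ∧ φ = all θ

end Formula

/-! ## Provability -/

open Formula in
/-- `Derives Γ φ`: the formula `φ` is derivable from the assumptions `Γ` in natural deduction for
classical two-sorted first order logic with equality on the number sort. Derivations live in a
context of `n` number variables and `m` set variables; the new variable of an introduction rule
for `∀` does not occur in the (weakened) assumptions. Both sorts are nonempty: for the number sort
this is witnessed by the closed terms, for the set sort it is the rule `setNonempty`. -/
inductive Derives : {n m : ℕ} → Set (Formula n m) → Formula n m → Prop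
  | ax {n m : ℕ} {Γ : Set (Formula n m)} {φ : Formula n m} : φ ∈ Γ → Derives Γ φ
  | impI {n m : ℕ} {Γ : Set (Formula n m)} {φ ψ : Formula n m} :
      Derives (insert φ Γ) ψ → Derives Γ (imp φ ψ)
  | impE {n m : ℕ} {Γ : Set (Formula n m)} {φ ψ : Formula n m} :
      Derives Γ (imp φ ψ) → Derives Γ φ → Derives Γ ψ
  | byContra {n m : ℕ} {Γ : Set (Formula n m)} {φ : Formula n m} :
      Derives (insert (neg φ) Γ) falsum → Derives Γ φ
  | allI {n m : ℕ} {Γ : Set (Formula n m)} {φ : Formula (n + 1) m} :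
      Derives (shiftNum '' Γ) φ → Derives Γ (all φ)
  | allE {n m : ℕ} {Γ : Set (Formula n m)} {φ : Formula (n + 1) m} (t : Term n) :
      Derives Γ (all φ) → Derives Γ (φ.instNum t)
  | allSetI {n m : ℕ} {Γ : Set (Formula n m)} {φ : Formula n (m + 1)} :
      Derives (shiftSet '' Γ) φ → Derives Γ (allSet φ)
  | allSetE {n m : ℕ} {Γ : Set (Formula n m)} {φ : Formula n (m + 1)} (X : Fin m) :
      Derives Γ (allSet φ) → Derives Γ (φ.instSet X)
  | setNonempty {n m : ℕ} {Γ : Set (Formula n m)} {φ : Formula n m} :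
      Derives (shiftSet '' Γ) φ.shiftSet → Derives Γ φ
  | eqRefl {n m : ℕ} {Γ : Set (Formula n m)} (t : Term n) : Derives Γ (eq t t)
  | eqSubst {n m : ℕ} {Γ : Set (Formula n m)} {φ : Formula (n + 1) m} {t u : Term n} :
      Derives Γ (eq t u) → Derives Γ (φ.instNum t) → Derives Γ (φ.instNum u)

/-! ## Axioms -/

open Formula Term

/-- The axioms of `PA⁻`, for the nonnegative part of a discretely ordered ring (free variables
are understood to be universally quantified). -/
inductive IsPAMinus : {n : ℕ} → Formula n 0 → Prop
  | add_assoc : IsPAMinus (n := 3)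
      (.eq (add (add (var 0) (var 1)) (var 2)) (add (var 0) (add (var 1) (var 2))))
  | add_comm : IsPAMinus (n := 2) (.eq (add (var 0) (var 1)) (add (var 1) (var 0)))
  | mul_assoc : IsPAMinus (n := 3)
      (.eq (mul (mul (var 0) (var 1)) (var 2)) (mul (var 0) (mul (var 1) (var 2))))
  | mul_comm : IsPAMinus (n := 2) (.eq (mul (var 0) (var 1)) (mul (var 1) (var 0)))
  | mul_add : IsPAMinus (n := 3)
      (.eq (mul (var 0) (add (var 1) (var 2)))
        (add (mul (var 0) (var 1)) (mul (var 0) (var 2))))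
  | add_zero : IsPAMinus (n := 1) (.eq (add (var 0) zero) (var 0))
  | mul_zero : IsPAMinus (n := 1) (.eq (mul (var 0) zero) zero)
  | mul_one : IsPAMinus (n := 1) (.eq (mul (var 0) one) (var 0))
  | lt_trans : IsPAMinus (n := 3)
      (imp (.lt (var 0) (var 1)) (imp (.lt (var 1) (var 2)) (.lt (var 0) (var 2))))
  | lt_irrefl : IsPAMinus (n := 1) (neg (.lt (var 0) (var 0)))
  | lt_total : IsPAMinus (n := 2)
      (.or (.lt (var 0) (var 1)) (.or (.eq (var 0) (var 1)) (.lt (var 1) (var 0))))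
  | add_lt_add : IsPAMinus (n := 3)
      (imp (.lt (var 0) (var 1)) (.lt (add (var 0) (var 2)) (add (var 1) (var 2))))
  | mul_lt_mul : IsPAMinus (n := 3)
      (imp (.lt zero (var 2)) (imp (.lt (var 0) (var 1))
        (.lt (mul (var 0) (var 2)) (mul (var 1) (var 2)))))
  | lt_exists_add : IsPAMinus (n := 2)
      (imp (.lt (var 0) (var 1)) (ex (.eq (add (var 1) (var 0)) (var 2))))
  | zero_lt_one : IsPAMinus (n := 0) (.lt zero one)
  | one_le : IsPAMinus (n := 1) (imp (.lt zero (var 0)) (le one (var 0)))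
  | zero_le : IsPAMinus (n := 1) (le zero (var 0))

/-- The induction axiom `φ(0) ∧ ∀ x (φ(x) → φ(x + 1)) → ∀ x φ(x)`. -/
def inductionFor {n m : ℕ} (φ : Formula (n + 1) m) : Formula n m :=
  imp
    (.and (φ.instNum zero)
      (all (imp φ (φ.subst (Fin.cons (add (var 0) one) fun i => var i.succ) id))))
    (all φ)

/-- The comprehension axiom `∃ X ∀ x (x ∈ X ↔ φ(x))`, with `X` not free in `φ`. -/
def comprehensionFor {n m : ℕ} (φ : Formula (n + 1) m) : Formula n m :=
  exSet (all (.iff (.mem (var 0) 0) φ.shiftSet))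

/-- The basic axioms. -/
def basicAxioms : Set Sentence := {σ | ∃ (n : ℕ) (φ : Formula n 0), IsPAMinus φ ∧ σ = closure φ}

/-- The `Σ⁰₁` induction scheme. -/
def sigma01Induction : Set Sentence :=
  {σ | ∃ (n m : ℕ) (φ : Formula (n + 1) m), φ.IsSigma01 ∧ σ = closure (inductionFor φ)}

/-- The recursive (`Δ⁰₁`) comprehension scheme. -/
def recursiveComprehension : Set Sentence :=
  {σ | ∃ (n m : ℕ) (φ ψ : Formula (n + 1) m), φ.IsSigma01 ∧ ψ.IsPi01 ∧
    σ = closure (imp (all (.iff φ ψ)) (comprehensionFor φ))}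

/-- The axioms of `RCA₀`. -/
def RCA₀ : Set Sentence := basicAxioms ∪ sigma01Induction ∪ recursiveComprehension

/-- The arithmetical comprehension scheme; the members of this set are its instances. -/
def arithmeticalComprehension : Set Sentence :=
  {σ | ∃ (n m : ℕ) (φ : Formula (n + 1) m), φ.IsArithmetical ∧ σ = closure (comprehensionFor φ)}

/-! ## Weak König's lemma

A triple `(k, (a, b))` describes the finite binary string of length `k` whose `i`-th entry, for
`i < k`, is `1` if `a * (i + 1) + 1` divides `b`, and `0` otherwise. The code of a string is the
least triple that describes it. Below, comments list the free variables in the order of their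
indices. -/

/-- `(i, a, b)`: `a * (i + 1) + 1` divides `b`. -/
def entryIsOne {m : ℕ} : Formula 3 m :=
  ex (.eq (mul (add (mul (var 2) (add (var 1) one)) one) (var 0)) (var 3))

/-- `(k, a, b, c, d)`: the strings of length `k` described by `(k, (a, b))` and `(k, (c, d))` are
equal. -/
def agreeBelow {m : ℕ} : Formula 5 m :=
  ball (var 0)
    (.iff (entryIsOne.subst ![var 0, var 2, var 3] id) (entryIsOne.subst ![var 0, var 4, var 5] id))

/-- `(s)`: `s` is the code of a finite binary string. In the scope of the quantifiers for
`k, a, b` the variables are `(b, a, k, s)`, and in that of those for `c, d` they are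
`(d, c, b, a, k, s)`. -/
def isString {m : ℕ} : Formula 1 m :=
  ex <| ex <| ex <| .and
    (.eq (var 3) (triple (var 2) (var 1) (var 0)))
    (all <| all <| imp
      (.lt (triple (var 4) (var 1) (var 0)) (var 5))
      (neg (agreeBelow.subst ![var 4, var 3, var 2, var 1, var 0] id)))

/-- `(s, t)`: the string described by `s` is an initial segment of the string described by `t`.
In the scope of the quantifiers for `k, a, b, l, c, d`, where `s = (k, (a, b))` and
`t = (l, (c, d))`, the variables are `(d, c, l, b, a, k, s, t)`. -/
def isInitialSegment {m : ℕ} : Formula 2 m :=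
  ex <| ex <| ex <| ex <| ex <| ex <| .and
    (.eq (var 6) (triple (var 5) (var 4) (var 3))) <| .and
    (.eq (var 7) (triple (var 2) (var 1) (var 0))) <| .and
    (le (var 5) (var 2))
    (agreeBelow.subst ![var 5, var 4, var 3, var 1, var 0] id)

/-- `T` (set variable `0`) is a subtree of the full binary tree: a set of (codes of) finite binary
strings that is closed under initial segments. In the second conjunct the variables are
`(s, t)`. -/
def isTree : Formula 0 1 :=
  .and
    (all (imp (.mem (var 0) 0) isString))
    (all <| all <| imp (.mem (var 1) 0) <| imp (isString.subst ![var 0] id) <| imp isInitialSegment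
      (.mem (var 0) 0))

/-- `T` (set variable `0`) is infinite. -/
def isInfinite : Formula 0 1 := all (ex (.and (.lt (var 1) (var 0)) (.mem (var 0) 0)))

/-- `P` (set variable `0`) is an infinite path through `T` (set variable `1`): for every `k` the
string of length `k` that consists of the first `k` values of the characteristic function of `P`
is in `T`. In the scope of the quantifiers for `k, a, b` the variables are `(b, a, k)`. -/
def isPath : Formula 0 2 :=
  all <| ex <| ex <| .and
    (.mem (triple (var 2) (var 1) (var 0)) 1)
    (ball (var 2) (.iff (.mem (var 0) 0) (entryIsOne.subst ![var 0, var 2, var 1] id)))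

/-- Weak König's lemma: every infinite subtree of the full binary tree has an infinite path. -/
def WKL : Sentence := allSet (imp (.and isTree isInfinite) (exSet isPath))

/-! ## Equivalence over a base theory -/

/-- The sets of sentences `S` and `S'` are equivalent over the base theory `T`: every member of
each is derivable from `T` together with the other. -/
def EquivalentOver (T S S' : Set Sentence) : Prop :=
  (∀ σ ∈ S', Derives (T ∪ S) σ) ∧ (∀ σ ∈ S, Derives (T ∪ S') σ)

end SecondOrderArithmetic

/-! The computable sets form an `ω`-model of `RCA₀` in which WKL fails: the tree of binary strings
that avoid the diagonal of the partial recursive functions is computable and infinite, but has no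
computable path. So it suffices that every instance of arithmetical comprehension provable from
`RCA₀` and WKL holds in this model; if `S` were equivalent to WKL, the model would satisfy `S`,
hence WKL by soundness.

Take such an instance, with computable parameters, and let B be the set whose existence it asserts.
The defining formula is arithmetical, so it defines the same B in every `ω`-model containing the
parameters. If B were not computable, some `ω`-model of `RCA₀` and WKL would omit B
(`exists_scott_model`), yet by soundness the instance would put B into it. Hence B is computable.

The omitting model comes from iterated cone avoidance (`Sig.exists_avoiding`): if B is not `Σ⁰₁` in
f, then every nonempty `Π⁰₁` class relative to f has a member X such that B is not `Σ⁰₁` in the join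
of f and X. The core is compactness (`Sig.forall_path`): if a `Σ⁰₁` definition computed B correctly
from every member of the class, B would already be `Σ⁰₁` in f. Bookkeeping (`exists_tower_avoiding`)
meets all classes relative to all stages, and the sets that are `Δ⁰₁` in some stage form the model.
-/

namespace SecondOrderArithmetic

/-! ### Semantics in `ω`-models. -/

/-- The value of a term in the standard model. -/
def Term.val {n : ℕ} (v : Fin n → ℕ) : Term n → ℕ
  | .var i => v i
  | .zero => 0
  | .one => 1
  | .add t u => t.val v + u.val v
  | .mul t u => t.val v * u.val v

/-- Satisfaction in the `ω`-model whose sets are the members of `M`. -/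
def Formula.Sat (M : Set (Set ℕ)) :
    {n m : ℕ} → Formula n m → (Fin n → ℕ) → (Fin m → Set ℕ) → Prop
  | _, _, .eq t u, v, _ => t.val v = u.val v
  | _, _, .lt t u, v, _ => t.val v < u.val v
  | _, _, .mem t X, v, V => t.val v ∈ V X
  | _, _, .falsum, _, _ => False
  | _, _, .imp φ ψ, v, V => φ.Sat M v V → ψ.Sat M v V
  | _, _, .all φ, v, V => ∀ x : ℕ, φ.Sat M (Fin.cons x v) V
  | _, _, .allSet φ, v, V => ∀ X ∈ M, φ.Sat M v (Fin.cons X V)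

namespace Term

theorem val_subst {n k : ℕ} (s : Fin n → Term k) (v : Fin k → ℕ) (t : Term n) :
    (t.subst s).val v = t.val fun i => (s i).val v := by
  induction t <;> simp_all [subst, val]

@[simp] theorem val_shift {n : ℕ} (v : Fin n → ℕ) (x : ℕ) (t : Term n) :
    t.shift.val (Fin.cons x v : Fin (n + 1) → ℕ) = t.val v := by
  simp [shift, val_subst, val]

end Term

namespace Formula

variable {M : Set (Set ℕ)}

theorem sat_subst {n m : ℕ} (φ : Formula n m) : ∀ {k l : ℕ} (s : Fin n → Term k)
    (r : Fin m → Fin l) (v : Fin k → ℕ) (V : Fin l → Set ℕ),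
    (φ.subst s r).Sat M v V ↔ φ.Sat M (fun i => (s i).val v) fun i => V (r i) := by
  induction φ with
  | eq t u => intros; simp [subst, Sat, Term.val_subst]
  | lt t u => intros; simp [subst, Sat, Term.val_subst]
  | mem t X => intros; simp [subst, Sat, Term.val_subst]
  | falsum => intros; simp [subst, Sat]
  | imp φ ψ h₁ h₂ => intros; simp [subst, Sat, h₁, h₂]
  | all φ h =>
    intro k l s r v V
    simp only [subst, Sat, h]
    refine forall_congr' fun x => ?_
    rw [iff_iff_eq]
    congr 1
    funext i
    refine Fin.cases ?_ (fun i => ?_) i <;> simp [Term.val]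
  | allSet φ h =>
    intro k l s r v V
    simp only [subst, Sat, h]
    refine forall₂_congr fun X _ => ?_
    rw [iff_iff_eq]
    congr 1
    funext i
    refine Fin.cases ?_ (fun i => ?_) i <;> simp

@[simp] theorem sat_shiftNum {n m : ℕ} (φ : Formula n m) (x : ℕ) (v : Fin n → ℕ)
    (V : Fin m → Set ℕ) : φ.shiftNum.Sat M (Fin.cons x v) V ↔ φ.Sat M v V := by
  simp [shiftNum, sat_subst, Term.val]

@[simp] theorem sat_shiftSet {n m : ℕ} (φ : Formula n m) (X : Set ℕ) (v : Fin n → ℕ)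
    (V : Fin m → Set ℕ) : φ.shiftSet.Sat M v (Fin.cons X V) ↔ φ.Sat M v V := by
  simp [shiftSet, sat_subst, Term.val]

@[simp] theorem sat_instNum {n m : ℕ} (φ : Formula (n + 1) m) (t : Term n) (v : Fin n → ℕ)
    (V : Fin m → Set ℕ) : (φ.instNum t).Sat M v V ↔ φ.Sat M (Fin.cons (t.val v) v) V := by
  rw [instNum, sat_subst, iff_iff_eq]
  congr 1
  funext i
  refine Fin.cases ?_ (fun i => ?_) i <;> simp [Term.val]

@[simp] theorem sat_instSet {n m : ℕ} (φ : Formula n (m + 1)) (X : Fin m) (v : Fin n → ℕ)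
    (V : Fin m → Set ℕ) : (φ.instSet X).Sat M v V ↔ φ.Sat M v (Fin.cons (V X) V) := by
  rw [instSet, sat_subst, iff_iff_eq]
  congr 1
  funext i
  refine Fin.cases ?_ (fun i => ?_) i <;> simp

section Connectives

variable {n m : ℕ} (v : Fin n → ℕ) (V : Fin m → Set ℕ)

@[simp] theorem sat_eq (t u : Term n) : (eq t u : Formula n m).Sat M v V ↔ t.val v = u.val v :=
  Iff.rfl

@[simp] theorem sat_lt (t u : Term n) : (lt t u : Formula n m).Sat M v V ↔ t.val v < u.val v :=
  Iff.rfl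

@[simp] theorem sat_mem (t : Term n) (X : Fin m) : (mem t X).Sat M v V ↔ t.val v ∈ V X :=
  Iff.rfl

@[simp] theorem sat_imp (φ ψ : Formula n m) :
    (imp φ ψ).Sat M v V ↔ (φ.Sat M v V → ψ.Sat M v V) := Iff.rfl

@[simp] theorem sat_all (φ : Formula (n + 1) m) :
    (all φ).Sat M v V ↔ ∀ x : ℕ, φ.Sat M (Fin.cons x v) V := Iff.rfl

@[simp] theorem sat_allSet (φ : Formula n (m + 1)) :
    (allSet φ).Sat M v V ↔ ∀ X ∈ M, φ.Sat M v (Fin.cons X V) := Iff.rfl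

@[simp] theorem sat_neg (φ : Formula n m) : φ.neg.Sat M v V ↔ ¬ φ.Sat M v V := Iff.rfl

@[simp] theorem sat_and (φ ψ : Formula n m) :
    (φ.and ψ).Sat M v V ↔ φ.Sat M v V ∧ ψ.Sat M v V := by
  simp [Formula.and]

@[simp] theorem sat_or (φ ψ : Formula n m) :
    (φ.or ψ).Sat M v V ↔ φ.Sat M v V ∨ ψ.Sat M v V := by
  simp [Formula.or, or_iff_not_imp_left]

@[simp] theorem sat_iff (φ ψ : Formula n m) :
    (φ.iff ψ).Sat M v V ↔ (φ.Sat M v V ↔ ψ.Sat M v V) := by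
  simp [Formula.iff, iff_iff_implies_and_implies]

@[simp] theorem sat_ex (φ : Formula (n + 1) m) :
    (ex φ).Sat M v V ↔ ∃ x : ℕ, φ.Sat M (Fin.cons x v) V := by
  simp [Formula.ex]

@[simp] theorem sat_exSet (φ : Formula n (m + 1)) :
    (exSet φ).Sat M v V ↔ ∃ X ∈ M, φ.Sat M v (Fin.cons X V) := by
  simp [Formula.exSet]

@[simp] theorem sat_le (t u : Term n) :
    (le t u : Formula n m).Sat M v V ↔ t.val v ≤ u.val v := by
  simp [Formula.le, le_iff_lt_or_eq]

@[simp] theorem sat_ball (t : Term n) (φ : Formula (n + 1) m) :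
    (ball t φ).Sat M v V ↔ ∀ x < t.val v, φ.Sat M (Fin.cons x v) V := by
  simp [Formula.ball, Term.val]

@[simp] theorem sat_bex (t : Term n) (φ : Formula (n + 1) m) :
    (bex t φ).Sat M v V ↔ ∃ x < t.val v, φ.Sat M (Fin.cons x v) V := by
  simp [Formula.bex, Term.val]

end Connectives

theorem sat_closeSets {n m : ℕ} (φ : Formula n m) (v : Fin n → ℕ) (V₀ : Fin 0 → Set ℕ) :
    φ.closeSets.Sat M v V₀ ↔ ∀ V : Fin m → Set ℕ, (∀ i, V i ∈ M) → φ.Sat M v V := by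
  induction m with
  | zero =>
    exact ⟨fun h V _ => Subsingleton.elim V₀ V ▸ h, fun h => h V₀ fun i => i.elim0⟩
  | succ m ih =>
    rw [closeSets, ih]
    refine ⟨fun h V hV => ?_, fun h V hV X hX => h _ fun i => ?_⟩
    · simpa using h (Fin.tail V) (fun i => hV i.succ) (V 0) (hV 0)
    · refine Fin.cases ?_ (fun i => ?_) i <;> simp [hX, hV]

theorem sat_closeNums {n : ℕ} (φ : Formula n 0) (v₀ : Fin 0 → ℕ) (V : Fin 0 → Set ℕ) :
    φ.closeNums.Sat M v₀ V ↔ ∀ v : Fin n → ℕ, φ.Sat M v V := by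
  induction n with
  | zero => exact ⟨fun h v => Subsingleton.elim v₀ v ▸ h, fun h => h v₀⟩
  | succ m ih =>
    rw [closeNums, ih]
    refine ⟨fun h v => ?_, fun h v x => h _⟩
    simpa using h (Fin.tail v) (v 0)

/-- Truth of a sentence in the `ω`-model `M`. -/
def Holds (M : Set (Set ℕ)) (σ : Sentence) : Prop := σ.Sat M Fin.elim0 Fin.elim0

theorem holds_closure {n m : ℕ} (φ : Formula n m) :
    Holds M φ.closure ↔ ∀ (v : Fin n → ℕ) (V : Fin m → Set ℕ), (∀ i, V i ∈ M) → φ.Sat M v V := by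
  simp [Holds, closure, sat_closeNums, sat_closeSets]

/-- Only set quantifiers consult the family of sets, so arithmetical formulas are absolute between
`ω`-models. This is where the argument depends on comprehension being arithmetical. -/
theorem IsArithmetical.sat_iff {N : Set (Set ℕ)} {n m : ℕ} {φ : Formula n m}
    (h : φ.IsArithmetical) (v : Fin n → ℕ) (V : Fin m → Set ℕ) : φ.Sat M v V ↔ φ.Sat N v V := by
  induction φ with
  | eq | lt | mem | falsum => rfl
  | imp φ ψ h₁ h₂ => simp [h₁ h.1, h₂ h.2]
  | all φ ih => exact forall_congr' fun x => ih h _ _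
  | allSet => exact h.elim

end Formula

/-! ### Soundness, and the axioms that hold in every `ω`-model. -/

open Formula

/-- Soundness. Free set variables range over `M` only, and `M` must be nonempty because of the rule
`setNonempty`. -/
theorem Derives.sat {M : Set (Set ℕ)} (hM : M.Nonempty) {n m : ℕ} {Γ : Set (Formula n m)}
    {φ : Formula n m} (h : Derives Γ φ) : ∀ (v : Fin n → ℕ) (V : Fin m → Set ℕ),
    (∀ i, V i ∈ M) → (∀ γ ∈ Γ, γ.Sat M v V) → φ.Sat M v V := by
  induction h with
  | ax h => exact fun v V _ hΓ => hΓ _ h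
  | impI _ ih =>
    intro v V hV hΓ hφ
    exact ih v V hV (by simpa [hφ] using hΓ)
  | impE _ _ ih₁ ih₂ => exact fun v V hV hΓ => ih₁ v V hV hΓ (ih₂ v V hV hΓ)
  | byContra _ ih =>
    intro v V hV hΓ
    by_contra hφ
    exact ih v V hV (by simpa [hφ] using hΓ)
  | allI _ ih =>
    intro v V hV hΓ x
    exact ih _ V hV (by simpa using hΓ)
  | allE t _ ih =>
    intro v V hV hΓ
    simpa using ih v V hV hΓ (t.val v)
  | allSetI _ ih =>
    intro v V hV hΓ X hX
    refine ih v _ (fun i => ?_) (by simpa using hΓ)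
    refine Fin.cases ?_ (fun i => ?_) i <;> simp [hX, hV]
  | allSetE X _ ih =>
    intro v V hV hΓ
    simpa using ih v V hV hΓ (V X) (hV X)
  | setNonempty _ ih =>
    intro v V hV hΓ
    obtain ⟨X, hX⟩ := hM
    have := ih v (Fin.cons X V) (fun i => ?_) (by simpa using hΓ)
    · simpa using this
    · refine Fin.cases ?_ (fun i => ?_) i <;> simp [hX, hV]
  | eqRefl t => exact fun _ _ _ _ => rfl
  | eqSubst _ _ ih₁ ih₂ =>
    intro v V hV hΓ
    have h₁ := ih₁ v V hV hΓ
    have h₂ := ih₂ v V hV hΓ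
    rw [sat_eq] at h₁
    simpa [← h₁] using h₂

theorem Derives.holds {M : Set (Set ℕ)} (hM : M.Nonempty) {Γ : Set Sentence} {σ : Sentence}
    (h : Derives Γ σ) (hΓ : ∀ γ ∈ Γ, Formula.Holds M γ) : Formula.Holds M σ :=
  h.sat hM _ _ (fun i => i.elim0) hΓ

theorem IsPAMinus.sat {M : Set (Set ℕ)} {n : ℕ} {φ : Formula n 0} (h : IsPAMinus φ)
    (v : Fin n → ℕ) (V : Fin 0 → Set ℕ) : φ.Sat M v V := by
  cases h <;> simp [Term.val]
  case add_assoc => ring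
  case add_comm => ring
  case mul_assoc => ring
  case mul_comm => ring
  case mul_add => ring
  case lt_trans => exact fun h₁ h₂ => h₁.trans h₂
  case lt_total => omega
  case mul_lt_mul => exact fun h₁ h₂ => Nat.mul_lt_mul_of_pos_right h₂ h₁
  case lt_exists_add => exact fun h => ⟨_, Nat.add_sub_of_le h.le⟩
  case one_le => omega

theorem holds_basicAxioms {M : Set (Set ℕ)} {σ : Sentence} (h : σ ∈ basicAxioms) :
    Formula.Holds M σ := by
  obtain ⟨n, φ, hφ, rfl⟩ := h
  exact (holds_closure φ).2 fun v V _ => hφ.sat v V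

theorem holds_sigma01Induction {M : Set (Set ℕ)} {σ : Sentence} (h : σ ∈ sigma01Induction) :
    Formula.Holds M σ := by
  obtain ⟨n, m, φ, -, rfl⟩ := h
  refine (holds_closure _).2 fun v V _ => ?_
  simp only [inductionFor, sat_imp, sat_and, sat_all, sat_instNum, and_imp, sat_subst]
  intro h0 hs x
  induction x with
  | zero => exact h0
  | succ x ih =>
    convert hs x ih using 1
    · funext i
      refine Fin.cases ?_ (fun i => ?_) i <;> simp [Term.val]
    · rfl

/-! ### Primitive recursive bounded quantification, and prefixes of sequences. -/

section PrimrecPred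

variable {α : Type*} [Primcodable α]

theorem primrecPred_exists_lt {p : α × ℕ → Prop} {b : α → ℕ} (hp : PrimrecPred p)
    (hb : Primrec b) : PrimrecPred fun a => ∃ x < b a, p (a, x) := by
  have h : PrimrecRel fun (x : ℕ) (a : α) => p (a, x) :=
    (hp.comp (Primrec.snd.pair Primrec.fst)).primrecRel
  exact (h.exists_mem_list.comp (Primrec.list_range.comp hb) Primrec.id).of_eq fun a => by simp

theorem primrecPred_forall_lt {p : α × ℕ → Prop} {b : α → ℕ} (hp : PrimrecPred p)
    (hb : Primrec b) : PrimrecPred fun a => ∀ x < b a, p (a, x) := by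
  have h : PrimrecRel fun (x : ℕ) (a : α) => p (a, x) :=
    (hp.comp (Primrec.snd.pair Primrec.fst)).primrecRel
  exact (h.forall_mem_list.comp (Primrec.list_range.comp hb) Primrec.id).of_eq fun a => by simp

theorem primrecPred_forall_mem {β : Type*} [Primcodable β] {p : α × β → Prop} {l : α → List β}
    (hp : PrimrecPred p) (hl : Primrec l) : PrimrecPred fun a => ∀ x ∈ l a, p (a, x) := by
  have h : PrimrecRel fun (x : β) (a : α) => p (a, x) :=
    (hp.comp (Primrec.snd.pair Primrec.fst)).primrecRel
  exact h.forall_mem_list.comp hl Primrec.id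

end PrimrecPred

/-- The list of the first `k` values of `f`. -/
def pre {β : Type*} (f : ℕ → β) (k : ℕ) : List β := (List.range k).map f

section Pre

variable {β γ : Type*} (f : ℕ → β)

@[simp] theorem length_pre (k : ℕ) : (pre f k).length = k := by simp [pre]

theorem getElem?_pre (k i : ℕ) : (pre f k)[i]? = if i < k then some (f i) else none := by
  split_ifs with h <;> simp [pre, h]

@[simp] theorem getElem_pre (k i : ℕ) (h : i < (pre f k).length) : (pre f k)[i] = f i := by
  simp [pre]

theorem take_pre (j k : ℕ) : (pre f k).take j = pre f (min j k) := by
  simp [pre, ← List.map_take, List.take_range]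

theorem take_pre_of_le {j k : ℕ} (h : j ≤ k) : (pre f k).take j = pre f j := by
  rw [take_pre, min_eq_left h]

theorem pre_prefix {j k : ℕ} (h : j ≤ k) : pre f j <+: pre f k := by
  rw [← take_pre_of_le f h]
  exact List.take_prefix _ _

theorem map_pre (h : β → γ) (k : ℕ) : (pre f k).map h = pre (fun n => h (f n)) k := by
  simp [pre]

theorem pre_eq_pre_iff {f g : ℕ → β} {k : ℕ} : pre f k = pre g k ↔ ∀ i < k, f i = g i := by
  simp [pre]

end Pre

theorem pre_prefix_pre_iff {β : Type*} {f g : ℕ → β} {k l : ℕ} :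
    pre f k <+: pre g l ↔ k ≤ l ∧ pre f k = pre g k := by
  constructor
  · intro h
    have hkl : k ≤ l := by simpa using h.length_le
    refine ⟨hkl, ?_⟩
    rw [List.prefix_iff_eq_take.1 h, length_pre, take_pre_of_le _ hkl]
  · rintro ⟨hkl, h⟩
    exact h ▸ pre_prefix g hkl

theorem pre_getD (σ : List Bool) : pre (fun i => σ.getD i false) σ.length = σ := by
  refine List.ext_getElem? fun i => ?_
  rw [getElem?_pre]
  split_ifs with hi <;> simp [hi]

/-! ### Closure properties of relative `Σ⁰₁` relations. -/

/-- `Q i` is `Σ⁰₁` in the oracle `o i`, uniformly in `i`: a member is accepted on the basis of a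
finite part of the oracle by a primitive recursive relation. -/
def Sig {ι α : Type*} [Primcodable α] (o : ι → ℕ → ℕ) (Q : ι → α → Prop) : Prop :=
  ∃ R : α → List ℕ → Prop, PrimrecRel R ∧ (∀ a σ τ, σ <+: τ → R a σ → R a τ) ∧
    ∀ i a, Q i a ↔ ∃ k, R a (pre (o i) k)

namespace Sig

variable {ι ι' α β : Type*} [Primcodable α] [Primcodable β] {o : ι → ℕ → ℕ}

/-- Any primitive recursive acceptance relation can be made monotone: accept a string as soon as one
of its prefixes was accepted. -/
theorem of_rel (R : α → List ℕ → Prop) (hR : PrimrecRel R) :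
    Sig o fun i a => ∃ k, R a (pre (o i) k) := by
  refine ⟨fun a τ => ∃ j < τ.length + 1, R a (τ.take j), ?_, ?_, fun i a => ?_⟩
  · refine PrimrecPred.primrecRel (p := fun a : α × List ℕ => ∃ j < a.2.length + 1,
      R a.1 (a.2.take j)) ?_
    refine primrecPred_exists_lt (p := fun q : (α × List ℕ) × ℕ => R q.1.1 (q.1.2.take q.2)) ?_
      (Primrec.succ.comp (Primrec.list_length.comp Primrec.snd))
    exact hR.comp (Primrec.fst.comp Primrec.fst)
      (Primrec.list_take.comp Primrec.snd (Primrec.snd.comp Primrec.fst))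
  · rintro a σ τ h ⟨j, hj, hR⟩
    have := h.length_le
    refine ⟨j, by omega, ?_⟩
    rcases h with ⟨ρ, rfl⟩
    rwa [List.take_append_of_le_length (by omega)]
  · constructor
    · rintro ⟨k, hk⟩
      exact ⟨k, k, by simp, by rwa [take_pre_of_le _ le_rfl]⟩
    · rintro ⟨k, j, -, hk⟩
      exact ⟨_, take_pre (o i) j k ▸ hk⟩

theorem congr {Q Q' : ι → α → Prop} (h : Sig o Q) (e : ∀ i a, Q' i a ↔ Q i a) : Sig o Q' := by
  obtain ⟨R, hR, hm, hQ⟩ := h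
  exact ⟨R, hR, hm, fun i a => (e i a).trans (hQ i a)⟩

theorem of_primrec {p : α → Prop} (hp : PrimrecPred p) : Sig o fun _ a => p a :=
  ⟨fun a _ => p a, (hp.comp Primrec.fst).primrecRel, fun _ _ _ _ h => h, fun _ _ => by simp⟩

theorem oracle {p : α × List ℕ → Prop} {b : α → ℕ} (hp : PrimrecPred p) (hb : Primrec b) :
    Sig o fun i a => p (a, pre (o i) (b a)) := by
  refine (of_rel (fun a τ => b a ≤ τ.length ∧ p (a, τ.take (b a))) ?_).congr fun i a => ?_
  · refine PrimrecPred.primrecRel (p := fun q : α × List ℕ => b q.1 ≤ q.2.length ∧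
      p (q.1, q.2.take (b q.1))) (.and ?_ ?_)
    · exact Primrec.nat_le.comp (hb.comp .fst) (Primrec.list_length.comp .snd)
    · exact hp.comp (Primrec.fst.pair (Primrec.list_take.comp (hb.comp .fst) .snd))
  · constructor
    · intro h
      exact ⟨b a, by simp, by rwa [take_pre_of_le _ le_rfl]⟩
    · rintro ⟨k, hk, h⟩
      rwa [take_pre_of_le _ (by simpa using hk)] at h

theorem or {P Q : ι → α → Prop} (hP : Sig o P) (hQ : Sig o Q) : Sig o fun i a => P i a ∨ Q i a := by
  obtain ⟨R, hR, hm, hP⟩ := hP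
  obtain ⟨R', hR', hm', hQ⟩ := hQ
  refine ⟨fun a τ => R a τ ∨ R' a τ, PrimrecPred.or hR hR', ?_, fun i a => ?_⟩
  · exact fun a σ τ h => Or.imp (hm a σ τ h) (hm' a σ τ h)
  · simp only [hP, hQ, exists_or]

theorem and {P Q : ι → α → Prop} (hP : Sig o P) (hQ : Sig o Q) :
    Sig o fun i a => P i a ∧ Q i a := by
  obtain ⟨R, hR, hm, hP⟩ := hP
  obtain ⟨R', hR', hm', hQ⟩ := hQ
  refine ⟨fun a τ => R a τ ∧ R' a τ, PrimrecPred.and hR hR', ?_, fun i a => ?_⟩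
  · exact fun a σ τ h => And.imp (hm a σ τ h) (hm' a σ τ h)
  · simp only [hP, hQ]
    constructor
    · rintro ⟨⟨k, hk⟩, l, hl⟩
      exact ⟨max k l, hm _ _ _ (pre_prefix _ (le_max_left k l)) hk,
        hm' _ _ _ (pre_prefix _ (le_max_right k l)) hl⟩
    · rintro ⟨k, hk, hl⟩
      exact ⟨⟨k, hk⟩, k, hl⟩

theorem comp {Q : ι → α → Prop} (h : Sig o Q) {g : β → α} (hg : Primrec g) :
    Sig o fun i b => Q i (g b) := by
  obtain ⟨R, hR, hm, hQ⟩ := h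
  exact ⟨fun b τ => R (g b) τ, hR.comp (hg.comp .fst) .snd, fun b => hm (g b),
    fun i b => hQ i (g b)⟩

theorem ex {Q : ι → α × ℕ → Prop} (h : Sig o Q) : Sig o fun i a => ∃ n, Q i (a, n) := by
  obtain ⟨R, hR, hm, hQ⟩ := h
  -- The length of the oracle prefix also bounds the search for the witness, which keeps the
  -- relation primitive recursive and monotone.
  refine ⟨fun a τ => ∃ n < τ.length, R (a, n) τ, ?_, ?_, fun i a => ?_⟩
  · refine primrecPred_exists_lt (p := fun q : (α × List ℕ) × ℕ => R (q.1.1, q.2) q.1.2) ?_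
      (Primrec.list_length.comp .snd)
    exact hR.comp ((Primrec.fst.comp .fst).pair .snd) (Primrec.snd.comp .fst)
  · rintro a σ τ hs ⟨n, hn, h⟩
    exact ⟨n, hn.trans_le hs.length_le, hm _ _ _ hs h⟩
  · simp only [hQ, length_pre]
    constructor
    · rintro ⟨n, k, hk⟩
      exact ⟨max (n + 1) k, n, by omega, hm _ _ _ (pre_prefix _ (le_max_right _ _)) hk⟩
    · rintro ⟨k, n, -, h⟩
      exact ⟨n, k, h⟩

theorem ball {Q : ι → α × ℕ → Prop} (h : Sig o Q) {b : α → ℕ} (hb : Primrec b) :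
    Sig o fun i a => ∀ n < b a, Q i (a, n) := by
  obtain ⟨R, hR, hm, hQ⟩ := h
  refine ⟨fun a τ => ∀ n < b a, R (a, n) τ, ?_, ?_, fun i a => ?_⟩
  · refine primrecPred_forall_lt (p := fun q : (α × List ℕ) × ℕ => R (q.1.1, q.2) q.1.2) ?_
      (hb.comp .fst)
    exact hR.comp ((Primrec.fst.comp .fst).pair .snd) (Primrec.snd.comp .fst)
  · exact fun a σ τ hs h n hn => hm _ _ _ hs (h n hn)
  · simp only [hQ]
    constructor
    · intro h
      choose k hk using h
      -- By monotonicity, the longest of the finitely many prefixes needed serves every `n < b a`.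
      refine ⟨(Finset.range (b a)).attach.sup fun n => k n (Finset.mem_range.1 n.2), fun n hn => ?_⟩
      refine hm _ _ _ (pre_prefix _ ?_) (hk n hn)
      exact Finset.le_sup (f := fun n : Finset.range (b a) => k n (Finset.mem_range.1 n.2))
        (Finset.mem_attach _ ⟨n, Finset.mem_range.2 hn⟩)
    · rintro ⟨k, h⟩ n hn
      exact ⟨k, h n hn⟩

theorem bex {Q : ι → α × ℕ → Prop} (h : Sig o Q) {b : α → ℕ} (hb : Primrec b) :
    Sig o fun i a => ∃ n < b a, Q i (a, n) :=
  ex (Q := fun i q => q.2 < b q.1 ∧ Q i q)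
    (and (of_primrec (Primrec.nat_lt.comp .snd (hb.comp .fst))) h)

/-- If each answer of the old oracle is computed from the answer of the new one at the same
argument, prefixes translate entry by entry, so acceptance transfers. -/
theorem reindex {Q : ι → α → Prop} (h : Sig o Q) {o' : ι' → ℕ → ℕ} (u : ι' → ι) {g : ℕ → ℕ}
    (hg : Primrec g) (hu : ∀ i n, o (u i) n = g (o' i n)) : Sig o' fun i a => Q (u i) a := by
  obtain ⟨R, hR, hm, hQ⟩ := h
  refine ⟨fun a τ => R a (τ.map g), ?_, fun a σ τ h => hm _ _ _ (h.map g), fun i a => ?_⟩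
  · exact hR.comp .fst (Primrec.list_map .snd (hg.comp .snd))
  · simp only [hQ, map_pre, ← hu]

end Sig

/-! ### The Cantor space relative to an oracle. -/

/-- `S` is `Σ⁰₁` in `f`. -/
abbrev SigmaIn {α : Type*} [Primcodable α] (f : ℕ → ℕ) (S : α → Prop) : Prop :=
  Sig (fun _ : Unit => f) fun _ => S

/-- The oracle that answers queries to `f` and to `X`. -/
def join (f : ℕ → ℕ) (X : ℕ → Bool) (n : ℕ) : ℕ := Nat.pair (f n) (X n).toNat

/-- The binary strings of length `k`. -/
def binaryStrings : ℕ → List (List Bool)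
  | 0 => [[]]
  | k + 1 => (binaryStrings k).flatMap fun σ => [σ ++ [false], σ ++ [true]]

theorem mem_binaryStrings {k : ℕ} {σ : List Bool} : σ ∈ binaryStrings k ↔ σ.length = k := by
  induction k generalizing σ with
  | zero => simp [binaryStrings]
  | succ k ih =>
    simp only [binaryStrings, List.mem_flatMap, ih]
    constructor
    · rintro ⟨τ, rfl, h⟩
      simp at h
      rcases h with rfl | rfl <;> simp
    · intro h
      obtain ⟨τ, b, rfl⟩ := List.eq_nil_or_concat σ |>.resolve_left (by rintro rfl; simp at h)
      refine ⟨τ, by simpa using h, ?_⟩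
      cases b <;> simp

theorem primrec_binaryStrings : Primrec binaryStrings := by
  refine (Primrec.nat_rec₁ (f := fun _ L => L.flatMap fun σ => [σ ++ [false], σ ++ [true]])
    [[]] ?_).of_eq fun k => ?_
  · refine Primrec.list_flatMap .snd ?_
    refine Primrec.list_cons.comp (Primrec.list_concat.comp .snd (.const _)) ?_
    exact Primrec.list_cons.comp (Primrec.list_concat.comp .snd (.const _)) (.const _)
  · induction k with
    | zero => rfl
    | succ k ih => simp [binaryStrings, ← ih]

/-- The prefix of `join f X` for a finite prefix of `f` and one of `X`. -/
def joinList (σ : List ℕ) (ρ : List Bool) : List ℕ :=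
  (List.range σ.length).map fun i => Nat.pair (σ.getD i 0) (ρ.getD i false).toNat

theorem joinList_pre (f : ℕ → ℕ) (X : ℕ → Bool) (k : ℕ) :
    joinList (pre f k) (pre X k) = pre (join f X) k := by
  rw [joinList, length_pre, pre]
  refine List.map_congr_left fun i hi => ?_
  rw [List.mem_range] at hi
  simp [List.getD_eq_getElem?_getD, pre, hi, join]

theorem primrec_joinList : Primrec₂ joinList := by
  refine Primrec.list_map (Primrec.list_range.comp (Primrec.list_length.comp .fst)) ?_
  refine Primrec₂.natPair.comp ?_ ((Primrec.dom_bool Bool.toNat).comp ?_)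
  · exact (Primrec.list_getD 0).comp (Primrec.fst.comp .fst) .snd
  · exact (Primrec.list_getD false).comp (Primrec.snd.comp .fst) .snd

/-- Membership depends on finitely many coordinates, so the set is the preimage of a subset of a
discrete space. -/
theorem isClopen_setOf_pre (p : List Bool → Prop) (k : ℕ) :
    IsClopen {X : ℕ → Bool | p (pre X k)} := by
  have h : Continuous fun (X : ℕ → Bool) (i : Fin k) => X i := by fun_prop
  have e : {X : ℕ → Bool | p (pre X k)} =
      (fun (X : ℕ → Bool) (i : Fin k) => X i) ⁻¹' {x | p (List.ofFn x)} := by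
    ext X
    simp only [Set.mem_ofPred_eq, Set.mem_preimage, pre]
    rw [List.ofFn_eq_map, ← List.map_coe_finRange_eq_range, List.map_map]
    rfl
  rw [e]
  exact (isClopen_discrete _).preimage h

namespace Sig

variable {α : Type*} [Primcodable α] {f : ℕ → ℕ}

theorem isOpen {Q : (ℕ → Bool) → α → Prop} (h : Sig (join f) Q) (a : α) : IsOpen {X | Q X a} := by
  obtain ⟨R, -, -, hQ⟩ := h
  simp only [hQ, Set.ofPred_exists, ← joinList_pre]
  exact isOpen_iUnion fun k => (isClopen_setOf_pre (fun ρ => R a (joinList (pre f k) ρ)) k).isOpen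

/-- Effective compactness of the Cantor space. -/
theorem forall_path {Q : (ℕ → Bool) → α → Prop} (h : Sig (join f) Q) :
    SigmaIn f fun a => ∀ X, Q X a := by
  obtain ⟨R, hR, hm, hQ⟩ := h
  -- Stage `k` checks that every binary string of length `k`, joined with the prefix of `f`, is
  -- accepted.
  refine (of_rel (fun a τ => ∀ ρ ∈ binaryStrings τ.length, R a (joinList τ ρ)) ?_).congr
    fun _ a => ?_
  · refine primrecPred_forall_mem (α := α × List ℕ)
      (p := fun q : (α × List ℕ) × List Bool => R q.1.1 (joinList q.1.2 q.2)) ?_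
      (primrec_binaryStrings.comp (Primrec.list_length.comp .snd))
    exact hR.comp (Primrec.fst.comp .fst) (primrec_joinList.comp (Primrec.snd.comp .fst) .snd)
  · constructor
    · intro h
      let U : ℕ → Set (ℕ → Bool) := fun k => {X | R a (pre (join f X) k)}
      have hU : ∀ k, IsOpen (U k) := fun k => by
        simp only [U, ← joinList_pre]
        exact (isClopen_setOf_pre (fun ρ => R a (joinList (pre f k) ρ)) k).isOpen
      have hmono : Monotone U := fun j k hjk X hX => hm _ _ _ (pre_prefix _ hjk) hX
      -- The open sets accepted by stage `k` increase with `k` and cover the space, so one of them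
      -- is everything.
      obtain ⟨k, hk⟩ := isCompact_univ.elim_directed_cover U hU
        (fun X _ => Set.mem_iUnion.2 ((hQ X a).1 (h X))) hmono.directed_le
      refine ⟨k, fun ρ hρ => ?_⟩
      obtain rfl : ρ.length = k := by simpa using mem_binaryStrings.1 hρ
      rw [← pre_getD ρ, length_pre, joinList_pre]
      exact hk (Set.mem_univ _)
    · rintro ⟨k, hk⟩ X
      refine (hQ X a).2 ⟨k, ?_⟩
      rw [← joinList_pre]
      exact hk _ (mem_binaryStrings.2 (by simp))

end Sig

/-- Conjugating by the encodings injects these functions into the countable type of computable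
functions on `ℕ`. -/
theorem countable_primrec (α β : Type*) [Primcodable α] [Primcodable β] :
    {f : α → β | Primrec f}.Countable := by
  let Φ (f : {f : α → β | Primrec f}) : {g : ℕ → ℕ // Computable g} :=
    ⟨fun n => Encodable.encode ((Encodable.decode n : Option α).map f.1),
      (Primrec.encode.comp (Primrec.option_map .decode (f.2.comp Primrec.snd).to₂)).to_comp⟩
  refine Function.Injective.countable (f := Φ) fun f g h => Subtype.ext (funext fun a => ?_)
  simpa [Φ] using congrFun (congrArg Subtype.val h) (Encodable.encode a)

theorem countable_primrecRel (α β : Type*) [Primcodable α] [Primcodable β] :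
    {R : α → β → Prop | PrimrecRel R}.Countable := by
  refine ((countable_primrec (α × β) Bool).image fun f a b => f (a, b) = true).mono ?_
  rintro R ⟨_, hR⟩
  exact ⟨_, hR, by simp⟩

/-! ### Cone avoidance. -/

section Avoiding

variable {f : ℕ → ℕ} {B : ℕ → Prop}

/-- One step of the forcing. A nonempty `Π⁰₁` class is given by its `Σ⁰₁` complement `Q`, and
enlarging `Q` shrinks the class. Either some member makes `R` enumerate a non-element of `B`, and a
finite prefix of it is fixed; or some member makes `R` miss an element of `B`, and missing it is
imposed as a `Π⁰₁` condition; or else `B` is `Σ⁰₁` in `f`. -/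
theorem Sig.exists_diagonal (hB : ¬ SigmaIn f B) {Q : (ℕ → Bool) → Unit → Prop}
    (hQ : Sig (join f) Q) (hX : ∃ X, ¬ Q X ()) {R : ℕ → List ℕ → Prop} (hR : PrimrecRel R) :
    ∃ Q' : (ℕ → Bool) → Unit → Prop, Sig (join f) Q' ∧ (∃ X, ¬ Q' X ()) ∧
      (∀ X, Q X () → Q' X ()) ∧
      ∀ X, ¬ Q' X () → ¬ ∀ n, B n ↔ ∃ k, R n (pre (join f X) k) := by
  have hφ : Sig (join f) fun X n => ∃ k, R n (pre (join f X) k) := .of_rel R hR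
  by_cases ha : ∃ n X, ¬ B n ∧ ¬ Q X () ∧ ∃ k, R n (pre (join f X) k)
  · obtain ⟨n, X, hn, hQX, k, hk⟩ := ha
    refine ⟨fun Y _ => Q Y () ∨ pre (join f Y) k ≠ pre (join f X) k, hQ.or ?_, ⟨X, by simpa⟩,
      fun Y h => .inl h, fun Y hY h => ?_⟩
    · exact .oracle (p := fun q : Unit × List ℕ => q.2 ≠ pre (join f X) k)
        (PrimrecPred.not (Primrec.eq.comp .snd (.const _))) (.const k)
    · rw [not_or, not_not] at hY
      exact hn ((h n).2 ⟨k, hY.2 ▸ hk⟩)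
  by_cases hb : ∃ n X, B n ∧ ¬ Q X () ∧ ¬ ∃ k, R n (pre (join f X) k)
  · obtain ⟨n, X, hn, hQX, hk⟩ := hb
    refine ⟨fun Y _ => Q Y () ∨ ∃ k, R n (pre (join f Y) k), hQ.or ?_, ⟨X, by simp_all⟩,
      fun Y h => .inl h, fun Y hY h => hY (.inr ((h n).1 hn))⟩
    exact hφ.comp (.const n)
  refine (hB ?_).elim
  -- With both cases excluded, `n` is in `B` exactly when every `X` is outside the class or
  -- enumerates `n`; by effective compactness this is `Σ⁰₁` in `f`.
  refine (Sig.forall_path ((hQ.comp (.const ())).or hφ)).congr fun _ n => ?_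
  constructor
  · intro hn X
    by_contra hX
    exact hb ⟨n, X, hn, not_or.1 hX⟩
  · intro h
    obtain ⟨X, hX⟩ := hX
    by_contra hn
    exact ha ⟨n, X, hn, hX, (h X).resolve_left hX⟩

/-- Cone avoidance for `Π⁰₁` classes. -/
theorem Sig.exists_avoiding (hB : ¬ SigmaIn f B) {Q : (ℕ → Bool) → Unit → Prop}
    (hQ : Sig (join f) Q) (hX : ∃ X, ¬ Q X ()) :
    ∃ X, ¬ Q X () ∧ ¬ SigmaIn (join f X) B := by
  let C := {Q : (ℕ → Bool) → Unit → Prop // Sig (join f) Q ∧ ∃ X, ¬ Q X ()}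
  have hstep : ∀ (c : C) (R : {R : ℕ → List ℕ → Prop | PrimrecRel R}), ∃ c' : C,
      (∀ X, c.1 X () → c'.1 X ()) ∧
        ∀ X, ¬ c'.1 X () → ¬ ∀ n, B n ↔ ∃ k, R.1 n (pre (join f X) k) := by
    intro c R
    obtain ⟨Q', h₁, h₂, h₃, h₄⟩ := Sig.exists_diagonal hB c.2.1 c.2.2 R.2
    exact ⟨⟨Q', h₁, h₂⟩, h₃, h₄⟩
  choose next hmono hdiag using hstep
  have : Countable {R : ℕ → List ℕ → Prop | PrimrecRel R} := (countable_primrecRel _ _).to_subtype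
  have : Nonempty {R : ℕ → List ℕ → Prop | PrimrecRel R} :=
    ⟨⟨fun n σ => n = σ.length, Primrec.eq.comp .fst (Primrec.list_length.comp .snd)⟩⟩
  obtain ⟨E, hE⟩ := exists_surjective_nat {R : ℕ → List ℕ → Prop | PrimrecRel R}
  -- Decreasing nonempty closed classes, the `e`-th step defeating the `e`-th candidate definition;
  -- a point of the intersection defeats them all.
  let c : ℕ → C := fun e => Nat.rec ⟨Q, hQ, hX⟩ (fun e c => next c (E e)) e
  obtain ⟨X, hX⟩ := IsCompact.nonempty_iInter_of_sequence_nonempty_isCompact_isClosed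
    (fun e => {X | ¬ (c e).1 X ()}) (fun e X hX h => hX (hmono _ _ X h)) (fun e => (c e).2.2)
    ((c 0).2.1.isOpen ()).isClosed_compl.isCompact fun e => ((c e).2.1.isOpen ()).isClosed_compl
  rw [Set.mem_iInter] at hX
  refine ⟨X, hX 0, ?_⟩
  rintro ⟨R, hR, -, h⟩
  obtain ⟨e, he⟩ := hE ⟨R, hR⟩
  refine hdiag (c e) (E e) X (hX (e + 1)) ?_
  rw [he]
  exact h ()

end Avoiding

/-! ### Towers of oracles and their models of `RCA₀`. -/

/-- `X` is `Δ⁰₁` in `f`. -/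
def Decides (f : ℕ → ℕ) (X : Set ℕ) : Prop := SigmaIn f (· ∈ X) ∧ SigmaIn f (· ∉ X)

/-- A sequence of oracles each of which is the first component of the next. -/
def IsTower (f : ℕ → ℕ → ℕ) : Prop := ∀ i n, f i n = (f (i + 1) n).unpair.1

/-- The Turing ideal generated by a tower. -/
def towerSets (f : ℕ → ℕ → ℕ) : Set (Set ℕ) := {X | ∃ i, Decides (f i) X}

theorem primrec_iterate_fst (k : ℕ) : Primrec fun n : ℕ => (fun x => x.unpair.1)^[k] n :=
  Primrec.nat_iterate (.const k) .id (Primrec.fst.comp (Primrec.unpair.comp .snd))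

namespace IsTower

variable {f : ℕ → ℕ → ℕ} (hf : IsTower f)
include hf

theorem apply_eq (i k n : ℕ) : f i n = (fun x => x.unpair.1)^[k] (f (i + k) n) := by
  induction k with
  | zero => rfl
  | succ k ih => rw [ih, hf (i + k) n, Function.iterate_succ_apply, Nat.add_assoc]

theorem sigmaIn_mono {α : Type*} [Primcodable α] {S : α → Prop} {i j : ℕ} (hij : i ≤ j)
    (h : SigmaIn (f i) S) : SigmaIn (f j) S := by
  obtain ⟨k, rfl⟩ := Nat.exists_eq_add_of_le hij
  exact h.reindex id (primrec_iterate_fst k) fun _ n => hf.apply_eq i k n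

theorem decides_mono {X : Set ℕ} {i j : ℕ} (hij : i ≤ j) (h : Decides (f i) X) :
    Decides (f j) X := ⟨hf.sigmaIn_mono hij h.1, hf.sigmaIn_mono hij h.2⟩

/-- Finitely many parameters appear by a common stage, the maximum of their individual ones. -/
theorem exists_decides {m : ℕ} {V : Fin m → Set ℕ} (hV : ∀ j, V j ∈ towerSets f) :
    ∃ i, ∀ j, Decides (f i) (V j) := by
  choose k hk using hV
  exact ⟨Finset.univ.sup k, fun j => hf.decides_mono (Finset.le_sup (Finset.mem_univ j)) (hk j)⟩

end IsTower

theorem primrec_term_val {n : ℕ} (t : Term n) : Primrec fun v : Fin n → ℕ => t.val v := by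
  induction t with
  | var i => exact Primrec.fin_app.comp .id (.const i)
  | zero => exact .const 0
  | one => exact .const 1
  | add t u ht hu => exact Primrec.nat_add.comp ht hu
  | mul t u ht hu => exact Primrec.nat_mul.comp ht hu

theorem primrec_cons {α : Type*} [Primcodable α] {n : ℕ} {g : α → ℕ} {v : α → Fin n → ℕ}
    (hg : Primrec g) (hv : Primrec v) :
    Primrec fun a => (Fin.cons (g a) (v a) : Fin (n + 1) → ℕ) := by
  refine Primrec.fin_curry.2 (Primrec₂.swap (Primrec.fin_curry₁.2 fun i => ?_))
  refine Fin.cases ?_ (fun i => ?_) i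
  · simpa using hg
  · simpa using Primrec.fin_app.comp hv (.const i)

/-- The two halves are proved together because implication and bounded quantifiers exchange them
under negation. -/
theorem Formula.IsBounded.sigmaIn {M : Set (Set ℕ)} {f : ℕ → ℕ} {n m : ℕ} {θ : Formula n m}
    (h : θ.IsBounded) {V : Fin m → Set ℕ} (hV : ∀ j, Decides f (V j)) :
    SigmaIn f (fun v => θ.Sat M v V) ∧ SigmaIn f (fun v => ¬ θ.Sat M v V) := by
  induction h with
  | eq t u =>
    have := Primrec.eq.comp (primrec_term_val t) (primrec_term_val u)
    exact ⟨.of_primrec this, .of_primrec this.not⟩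
  | lt t u =>
    have := Primrec.nat_lt.comp (primrec_term_val t) (primrec_term_val u)
    exact ⟨.of_primrec this, .of_primrec this.not⟩
  | mem t X => exact ⟨(hV X).1.comp (primrec_term_val t), (hV X).2.comp (primrec_term_val t)⟩
  | falsum =>
    exact ⟨.of_primrec (Primrec.eq.comp (.const 0) (.const 1) |>.of_eq fun _ => by simp [Sat]),
      .of_primrec (Primrec.eq.comp (.const 0) (.const 0) |>.of_eq fun _ => by simp [Sat])⟩
  | imp _ _ ih₁ ih₂ =>
    refine ⟨((ih₁ hV).2.or (ih₂ hV).1).congr fun _ v => ?_,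
      ((ih₁ hV).1.and (ih₂ hV).2).congr fun _ v => ?_⟩
    · simp [imp_iff_not_or]
    · simp
  | ball t _ ih =>
    refine ⟨(((ih hV).1.comp (primrec_cons .snd .fst)).ball (primrec_term_val t)).congr fun _ v => ?_,
      (((ih hV).2.comp (primrec_cons .snd .fst)).bex (primrec_term_val t)).congr fun _ v => ?_⟩ <;> simp
  | bex t _ ih =>
    refine ⟨(((ih hV).1.comp (primrec_cons .snd .fst)).bex (primrec_term_val t)).congr fun _ v => ?_,
      (((ih hV).2.comp (primrec_cons .snd .fst)).ball (primrec_term_val t)).congr fun _ v => ?_⟩ <;> simp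

/-- The defining condition leaves only one possible witness. -/
theorem Formula.sat_comprehensionFor {M : Set (Set ℕ)} {n m : ℕ} (φ : Formula (n + 1) m)
    (v : Fin n → ℕ) (V : Fin m → Set ℕ) :
    (comprehensionFor φ).Sat M v V ↔ {x | φ.Sat M (Fin.cons x v) V} ∈ M := by
  simp only [comprehensionFor, sat_exSet, sat_all, sat_iff, sat_mem, sat_shiftSet]
  constructor
  · rintro ⟨X, hX, h⟩
    convert hX
    ext x
    exact (h x).symm
  · exact fun h => ⟨_, h, fun x => Iff.rfl⟩

theorem IsTower.holds_recursiveComprehension {f : ℕ → ℕ → ℕ} (hf : IsTower f) {σ : Sentence}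
    (h : σ ∈ recursiveComprehension) : Holds (towerSets f) σ := by
  obtain ⟨n, m, φ, ψ, ⟨θ, hθ, rfl⟩, ⟨η, hη, rfl⟩, rfl⟩ := h
  refine (holds_closure _).2 fun v V hV => ?_
  rw [sat_imp, sat_comprehensionFor]
  intro he
  simp only [sat_all, sat_iff, sat_ex] at he
  obtain ⟨i, hi⟩ := hf.exists_decides hV
  have hc : Primrec fun q : ℕ × ℕ =>
      (Fin.cons q.2 (Fin.cons q.1 v : Fin (n + 1) → ℕ) : Fin (n + 1 + 1) → ℕ) :=
    primrec_cons .snd (primrec_cons .fst (.const v))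
  -- The `Σ⁰₁` form enumerates the set, and the negated `Π⁰₁` form enumerates its complement.
  refine ⟨i, ((hθ.sigmaIn (M := towerSets f) hi).1.comp hc).ex.congr fun _ x => ?_,
    ((hη.sigmaIn (M := towerSets f) hi).2.comp hc).ex.congr fun _ x => ?_⟩
  · exact sat_ex _ _ _
  · simp [he]

theorem IsTower.holds_RCA₀ {f : ℕ → ℕ → ℕ} (hf : IsTower f) {σ : Sentence} (h : σ ∈ RCA₀) :
    Holds (towerSets f) σ := by
  rcases h with (h | h) | h
  · exact holds_basicAxioms h
  · exact holds_sigma01Induction h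
  · exact hf.holds_recursiveComprehension h

theorem decides_of_primrecPred {f : ℕ → ℕ} {X : Set ℕ} (h : PrimrecPred (· ∈ X)) : Decides f X :=
  ⟨.of_primrec h, .of_primrec h.not⟩

/-! ### Arithmetic coding of binary strings. -/

/-- The pairing function of the coding of strings. -/
def quadPair (x y : ℕ) : ℕ := (x + y) * (x + y) + x

def quadFst (n : ℕ) : ℕ := n - n.sqrt * n.sqrt

def quadSnd (n : ℕ) : ℕ := n.sqrt - quadFst n

theorem sqrt_quadPair (x y : ℕ) : (quadPair x y).sqrt = x + y :=
  Nat.sqrt_add_eq _ (by omega)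

@[simp] theorem quadFst_quadPair (x y : ℕ) : quadFst (quadPair x y) = x := by
  rw [quadFst, sqrt_quadPair, quadPair, Nat.add_sub_cancel_left]

@[simp] theorem quadSnd_quadPair (x y : ℕ) : quadSnd (quadPair x y) = y := by
  rw [quadSnd, quadFst_quadPair, sqrt_quadPair, Nat.add_sub_cancel_left]

theorem primrec_quadPair : Primrec₂ quadPair :=
  Primrec.nat_add.comp (Primrec.nat_mul.comp Primrec.nat_add Primrec.nat_add) .fst

theorem primrec_quadFst : Primrec quadFst :=
  Primrec.nat_sub.comp .id (Primrec.nat_mul.comp Primrec.nat_sqrt Primrec.nat_sqrt)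

theorem primrec_quadSnd : Primrec quadSnd := Primrec.nat_sub.comp Primrec.nat_sqrt primrec_quadFst

/-- The infinite binary sequence described by the parameters `a` and `b`. -/
def bits (a b i : ℕ) : Bool := decide (b % (a * (i + 1) + 1) = 0)

theorem bits_eq_true {a b i : ℕ} : bits a b i = true ↔ a * (i + 1) + 1 ∣ b := by
  simp [bits, Nat.dvd_iff_mod_eq_zero]

/-- Gödel's beta function: with `a = k!` the moduli `a * (i + 1) + 1` for `i < k` are pairwise
coprime, since differences of indices divide `k!`. Taking for `b` the product of the selected
moduli, no other modulus divides it. -/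
theorem exists_bits_eq (p : ℕ → Prop) (k : ℕ) :
    ∃ a b, ∀ i < k, bits a b i = true ↔ p i := by
  classical
  have hco : ∀ i < k, ∀ j < k, i < j →
      Nat.Coprime (k.factorial * (i + 1) + 1) (k.factorial * (j + 1) + 1) := by
    intro i hi j hj hij
    rw [mul_comm, mul_comm k.factorial]
    exact Nat.coprime_mul_succ (Nat.dvd_factorial (by omega) (by omega))
  refine ⟨k.factorial, ∏ i ∈ Finset.range k with p i, (k.factorial * (i + 1) + 1),
    fun i hi => ?_⟩
  rw [bits_eq_true]
  refine ⟨fun h => ?_, fun h => Finset.dvd_prod_of_mem _ (by simp [hi, h])⟩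
  by_contra hp
  have : Nat.Coprime (k.factorial * (i + 1) + 1)
      (∏ i ∈ Finset.range k with p i, (k.factorial * (i + 1) + 1)) := by
    refine Nat.Coprime.prod_right fun j hj => ?_
    rw [Finset.mem_filter, Finset.mem_range] at hj
    rcases lt_trichotomy i j with hij | rfl | hij
    · exact hco i hi j hj.1 hij
    · exact (hp hj.2).elim
    · exact (hco j hj.1 i hi hij).symm
  have := Nat.Coprime.eq_one_of_dvd this h
  have : 0 < k.factorial * (i + 1) := Nat.mul_pos k.factorial_pos (Nat.succ_pos i)
  omega

/-- The triple `(k, (a, b))`. -/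
def quadTriple (k a b : ℕ) : ℕ := quadPair k (quadPair a b)

def IsTriple (s : ℕ) : Prop :=
  quadTriple (quadFst s) (quadFst (quadSnd s)) (quadSnd (quadSnd s)) = s

/-- The string described by a triple. -/
def stringOf (s : ℕ) : List Bool :=
  pre (bits (quadFst (quadSnd s)) (quadSnd (quadSnd s))) (quadFst s)

@[simp] theorem isTriple_quadTriple (k a b : ℕ) : IsTriple (quadTriple k a b) := by
  simp [IsTriple, quadTriple]

@[simp] theorem stringOf_quadTriple (k a b : ℕ) : stringOf (quadTriple k a b) = pre (bits a b) k := by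
  simp [stringOf, quadTriple]

theorem IsTriple.exists_eq {s : ℕ} (h : IsTriple s) : ∃ k a b, s = quadTriple k a b :=
  ⟨_, _, _, h.symm⟩

/-- `s` is the least triple that describes the string `σ`. -/
def IsCode (s : ℕ) (σ : List Bool) : Prop :=
  (IsTriple s ∧ stringOf s = σ) ∧ ∀ r < s, ¬ (IsTriple r ∧ stringOf r = σ)

theorem IsCode.unique {s t : ℕ} {σ : List Bool} (hs : IsCode s σ) (ht : IsCode t σ) : s = t :=
  le_antisymm (not_lt.1 fun h => hs.2 t h ht.1) (not_lt.1 fun h => ht.2 s h hs.1)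

theorem exists_isCode (σ : List Bool) : ∃ s, IsCode s σ := by
  classical
  have h : ∃ s, IsTriple s ∧ stringOf s = σ := by
    obtain ⟨a, b, h⟩ := exists_bits_eq (fun i => σ.getD i false = true) σ.length
    refine ⟨quadTriple σ.length a b, by simp, ?_⟩
    rw [stringOf_quadTriple]
    conv_rhs => rw [← pre_getD σ]
    exact pre_eq_pre_iff.2 fun i hi => Bool.eq_iff_iff.2 (h i hi)
  exact ⟨Nat.find h, Nat.find_spec h, fun r hr => Nat.find_min h hr⟩

theorem primrecPred_isTriple : PrimrecPred IsTriple :=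
  Primrec.eq.comp (primrec_quadPair.comp primrec_quadFst (primrec_quadPair.comp
    (primrec_quadFst.comp primrec_quadSnd) (primrec_quadSnd.comp primrec_quadSnd))) .id

theorem primrec_stringOf : Primrec stringOf := by
  refine Primrec.list_map (Primrec.list_range.comp primrec_quadFst) ?_
  refine PrimrecPred.decide (p := fun q : ℕ × ℕ => quadSnd (quadSnd q.1) %
    (quadFst (quadSnd q.1) * (q.2 + 1) + 1) = 0) ?_
  refine Primrec.eq.comp (Primrec.nat_mod.comp ?_ (Primrec.succ.comp (Primrec.nat_mul.comp ?_
    (Primrec.succ.comp .snd)))) (.const 0)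
  · exact primrec_quadSnd.comp (primrec_quadSnd.comp .fst)
  · exact primrec_quadFst.comp (primrec_quadSnd.comp .fst)

theorem primrecRel_isCode : PrimrecRel IsCode := by
  have h : PrimrecPred fun q : ℕ × List Bool => IsTriple q.1 ∧ stringOf q.1 = q.2 :=
    (primrecPred_isTriple.comp .fst).and (Primrec.eq.comp (primrec_stringOf.comp .fst) .snd)
  refine h.and (primrecPred_forall_lt (p := fun q : (ℕ × List Bool) × ℕ =>
    ¬ (IsTriple q.2 ∧ stringOf q.2 = q.1.2)) ?_ .fst)
  exact (h.comp (Primrec.snd.pair (Primrec.snd.comp .fst))).not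

/-! ### Trees and paths -/

section

variable {M : Set (Set ℕ)}

theorem sat_entryIsOne {m : ℕ} (v : Fin 3 → ℕ) (V : Fin m → Set ℕ) :
    entryIsOne.Sat M v V ↔ bits (v 1) (v 2) (v 0) = true := by
  rw [bits_eq_true, dvd_iff_exists_eq_mul_right]
  simp only [entryIsOne, sat_ex, sat_eq, Term.val]
  exact exists_congr fun _ => eq_comm

theorem sat_agreeBelow {m : ℕ} (v : Fin 5 → ℕ) (V : Fin m → Set ℕ) :
    agreeBelow.Sat M v V ↔ pre (bits (v 1) (v 2)) (v 0) = pre (bits (v 3) (v 4)) (v 0) := by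
  rw [pre_eq_pre_iff]
  simp only [agreeBelow, sat_ball, sat_iff, sat_subst, sat_entryIsOne]
  exact forall₂_congr fun i _ => Bool.eq_iff_iff.symm

theorem sat_isString {m : ℕ} (v : Fin 1 → ℕ) (V : Fin m → Set ℕ) :
    isString.Sat M v V ↔ IsCode (v 0) (stringOf (v 0)) := by
  have : isString.Sat M v V ↔ ∃ k a b, v 0 = quadTriple k a b ∧
      ∀ c d, quadTriple k c d < v 0 → ¬ pre (bits a b) k = pre (bits c d) k := by
    simp only [isString, sat_ex, sat_and, sat_all, sat_imp, sat_neg, sat_subst, sat_agreeBelow]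
    rfl
  rw [this]
  constructor
  · rintro ⟨k, a, b, h, hmin⟩
    refine ⟨⟨h ▸ isTriple_quadTriple k a b, rfl⟩, ?_⟩
    rintro r hr ⟨ht, he⟩
    obtain ⟨l, c, d, rfl⟩ := ht.exists_eq
    rw [h, stringOf_quadTriple, stringOf_quadTriple] at he
    -- The formula compares only triples with the same length entry, while `IsCode` compares all
    -- triples; equal strings have equal lengths.
    obtain rfl : l = k := by simpa using congrArg List.length he
    exact hmin c d hr he.symm
  · rintro ⟨⟨ht, -⟩, hmin⟩
    obtain ⟨k, a, b, h⟩ := ht.exists_eq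
    refine ⟨k, a, b, h, fun c d hlt he => hmin _ hlt ⟨isTriple_quadTriple k c d, ?_⟩⟩
    rw [h, stringOf_quadTriple, stringOf_quadTriple, he]

theorem sat_isInitialSegment {m : ℕ} (v : Fin 2 → ℕ) (V : Fin m → Set ℕ) :
    isInitialSegment.Sat M v V ↔
      IsTriple (v 0) ∧ IsTriple (v 1) ∧ stringOf (v 0) <+: stringOf (v 1) := by
  have : isInitialSegment.Sat M v V ↔ ∃ k a b l c d, v 0 = quadTriple k a b ∧
      v 1 = quadTriple l c d ∧ k ≤ l ∧ pre (bits a b) k = pre (bits c d) k := by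
    simp only [isInitialSegment, sat_ex, sat_and, sat_le, sat_subst, sat_agreeBelow]
    rfl
  rw [this]
  constructor
  · rintro ⟨k, a, b, l, c, d, h₀, h₁, h⟩
    simpa [h₀, h₁] using pre_prefix_pre_iff.2 h
  · rintro ⟨h₀, h₁, h⟩
    obtain ⟨k, a, b, h₀⟩ := h₀.exists_eq
    obtain ⟨l, c, d, h₁⟩ := h₁.exists_eq
    rw [h₀, h₁, stringOf_quadTriple, stringOf_quadTriple] at h
    exact ⟨k, a, b, l, c, d, h₀, h₁, pre_prefix_pre_iff.1 h⟩

theorem sat_isTree (v : Fin 0 → ℕ) (V : Fin 1 → Set ℕ) :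
    isTree.Sat M v V ↔ (∀ s ∈ V 0, IsCode s (stringOf s)) ∧
      ∀ t ∈ V 0, ∀ s, IsCode s (stringOf s) → stringOf s <+: stringOf t → s ∈ V 0 := by
  have : isTree.Sat M v V ↔ (∀ s ∈ V 0, IsCode s (stringOf s)) ∧
      ∀ t s, t ∈ V 0 → IsCode s (stringOf s) →
        (IsTriple s ∧ IsTriple t ∧ stringOf s <+: stringOf t) → s ∈ V 0 := by
    simp only [isTree, sat_and, sat_all, sat_imp, sat_subst, sat_isString, sat_isInitialSegment]
    rfl
  rw [this]
  refine and_congr_right fun hc => ⟨fun h t ht s hs hst => ?_, fun h t s ht hs hst => ?_⟩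
  · exact h t s ht hs ⟨hs.1.1, (hc t ht).1.1, hst⟩
  · exact h t ht s hs hst.2.2

theorem sat_isInfinite (v : Fin 0 → ℕ) (V : Fin 1 → Set ℕ) :
    isInfinite.Sat M v V ↔ (V 0).Infinite := by
  have : isInfinite.Sat M v V ↔ ∀ n, ∃ s, n < s ∧ s ∈ V 0 := by
    simp only [isInfinite, sat_all, sat_ex, sat_and]
    rfl
  rw [this]
  refine ⟨fun h => Set.infinite_of_forall_exists_gt fun n => ?_, fun h n => ?_⟩
  · obtain ⟨s, hs, h⟩ := h n
    exact ⟨s, h, hs⟩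
  · obtain ⟨s, h, hs⟩ := h.exists_gt n
    exact ⟨s, hs, h⟩

theorem sat_isPath (v : Fin 0 → ℕ) (V : Fin 2 → Set ℕ) :
    isPath.Sat M v V ↔
      ∀ k, ∃ a b, quadTriple k a b ∈ V 1 ∧ ∀ i < k, i ∈ V 0 ↔ bits a b i = true := by
  simp only [isPath, sat_all, sat_ex, sat_and, sat_ball, sat_iff, sat_subst, sat_entryIsOne]
  rfl

/-- `T` is an infinite tree of codes of binary strings. -/
structure IsInfiniteTree (T : Set ℕ) : Prop where
  isCode : ∀ s ∈ T, IsCode s (stringOf s)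
  of_prefix : ∀ t ∈ T, ∀ s, IsCode s (stringOf s) → stringOf s <+: stringOf t → s ∈ T
  infinite : T.Infinite

/-- The sequence `X` is a path through `T`. -/
def IsPathThrough (T : Set ℕ) (X : ℕ → Bool) : Prop := ∀ k, ∃ s ∈ T, stringOf s = pre X k

theorem holds_WKL : Holds M WKL ↔
    ∀ T ∈ M, IsInfiniteTree T → ∃ X : ℕ → Bool, {i | X i = true} ∈ M ∧ IsPathThrough T X := by
  classical
  simp only [Holds, WKL, sat_allSet, sat_imp, sat_and, sat_exSet, sat_isTree, sat_isInfinite,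
    sat_isPath]
  refine forall₂_congr fun T _ => ⟨fun h hT => ?_, fun h hT => ?_⟩
  · obtain ⟨P, hP, h⟩ := h ⟨⟨hT.1, hT.2⟩, hT.3⟩
    refine ⟨fun i => decide (i ∈ P), by simpa using hP, fun k => ?_⟩
    obtain ⟨a, b, hT, h⟩ := h k
    refine ⟨_, hT, ?_⟩
    rw [stringOf_quadTriple, pre_eq_pre_iff]
    exact fun i hi => Bool.eq_iff_iff.2 (by simpa using (h i hi).symm)
  · have hT' : IsInfiniteTree T := ⟨hT.1.1, hT.1.2, hT.2⟩
    obtain ⟨X, hX, h⟩ := h hT'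
    refine ⟨_, hX, fun k => ?_⟩
    obtain ⟨s, hs, h⟩ := h k
    obtain ⟨l, a, b, rfl⟩ := (hT'.isCode s hs).1.1.exists_eq
    rw [stringOf_quadTriple] at h
    obtain rfl : l = k := by simpa using congrArg List.length h
    refine ⟨a, b, hs, fun i hi => ?_⟩
    rw [pre_eq_pre_iff] at h
    exact Bool.eq_iff_iff.1 (h i hi).symm

end

/-! ### Construction of `ω`-models of weak König's lemma. -/

/-- Cone avoidance is iterated along an enumeration of pairs `(j, e)`: step `i = Nat.pair j e`
treats the `e`-th `Π⁰₁` class relative to stage `j`, read from stage `i` by taking first components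
`i - j` times. -/
theorem exists_tower_avoiding {B : ℕ → Prop} (hB : ¬ SigmaIn (fun _ => 0) B) :
    ∃ f : ℕ → ℕ → ℕ, IsTower f ∧ (∀ i, ¬ SigmaIn (f i) B) ∧
      ∀ j (Q : (ℕ → Bool) → Unit → Prop), Sig (join (f j)) Q → (∃ X, ¬ Q X ()) →
        ∃ X, ¬ Q X () ∧ ∃ i, f (i + 1) = join (f i) X := by
  let Rel := {R : Unit → List ℕ → Prop | PrimrecRel R}
  have : Countable Rel := (countable_primrecRel _ _).to_subtype
  have : Nonempty Rel :=
    ⟨⟨fun _ σ => σ.length = 0, Primrec.eq.comp (Primrec.list_length.comp .snd) (.const 0)⟩⟩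
  obtain ⟨E, hE⟩ := exists_surjective_nat Rel
  let proj (k n : ℕ) : ℕ := (fun x => x.unpair.1)^[k] n
  have hproj (k : ℕ) : Primrec (proj k) := primrec_iterate_fst k
  let Oracle := {f : ℕ → ℕ // ¬ SigmaIn f B}
  let Q (f : Oracle) (k e : ℕ) (X : ℕ → Bool) : Prop :=
    ∃ l, (E e).1 () (pre (join (fun n => proj k (f.1 n)) X) l)
  have hstep : ∀ (f : Oracle) (k e : ℕ), ∃ f' : Oracle, (∀ n, f.1 n = (f'.1 n).unpair.1) ∧
      ((∃ X, ¬ Q f k e X) → ∃ X, ¬ Q f k e X ∧ f'.1 = join f.1 X) := by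
    intro f k e
    have hQ : Sig (join f.1) fun X (_ : Unit) => Q f k e X := by
      refine (Sig.of_rel (o := join fun n => proj k (f.1 n)) (E e).1 (E e).2).reindex id
        (g := fun n => Nat.pair (proj k n.unpair.1) n.unpair.2) ?_ fun X n => by simp [join]
      exact Primrec₂.natPair.comp ((hproj k).comp (Primrec.fst.comp .unpair))
        (Primrec.snd.comp .unpair)
    by_cases hX : ∃ X, ¬ Q f k e X
    · obtain ⟨X, hX, hXB⟩ := Sig.exists_avoiding f.2 hQ hX
      exact ⟨⟨_, hXB⟩, fun n => by simp [join], fun _ => ⟨X, hX, rfl⟩⟩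
    -- The class is empty, so any extension preserving avoidance will do; it is taken from the whole
    -- Cantor space.
    · have hF : PrimrecPred fun _ : Unit => False :=
        (Primrec.eq.comp (.const 0) (.const 1)).of_eq fun _ => by simp
      obtain ⟨X, -, hXB⟩ := Sig.exists_avoiding f.2 (.of_primrec hF) ⟨fun _ => false, id⟩
      exact ⟨⟨_, hXB⟩, fun n => by simp [join], fun h => (hX h).elim⟩
  choose next hnext hpath using hstep
  let F : ℕ → Oracle := fun i =>
    Nat.rec ⟨_, hB⟩ (fun i f => next f (i - i.unpair.1) i.unpair.2) i
  have hF : IsTower fun i => (F i).1 := fun i n => hnext _ _ _ n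
  refine ⟨fun i => (F i).1, hF, fun i => (F i).2, ?_⟩
  rintro j Q' ⟨R, hR, -, hQ'⟩ ⟨X, hX⟩
  obtain ⟨e, he⟩ := hE ⟨R, hR⟩
  -- Since `j ≤ Nat.pair j e`, stage `j` is already available when its class is treated.
  obtain ⟨k, hk⟩ := Nat.exists_eq_add_of_le (Nat.left_le_pair j e)
  have hQ (X : ℕ → Bool) : Q (F (Nat.pair j e)) k e X ↔ Q' X () := by
    have hj : (F j).1 = fun n => proj k ((F (Nat.pair j e)).1 n) := by
      funext n
      rw [hk]
      exact hF.apply_eq j k n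
    simp only [Q, hQ', he, ← hj]
  have := hpath (F (Nat.pair j e)) k e ⟨X, fun h => hX ((hQ X).1 h)⟩
  obtain ⟨Y, hY, hf⟩ := this
  refine ⟨Y, fun h => hY ((hQ Y).2 h), Nat.pair j e, ?_⟩
  rw [← hf]
  have hk' : Nat.pair j e - j = k := by omega
  change (next _ _ _).1 = _
  simp only [Nat.unpair_pair, hk']
  rfl

/-- König's lemma: the paths through an infinite tree form a nonempty class. -/
theorem IsInfiniteTree.exists_path {T : Set ℕ} (hT : IsInfiniteTree T) :
    ∃ X : ℕ → Bool, ∀ k s, IsCode s (pre X k) → s ∈ T := by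
  have key := IsCompact.nonempty_iInter_of_sequence_nonempty_isCompact_isClosed
    (fun k => {X : ℕ → Bool | ∀ s, IsCode s (pre X k) → s ∈ T}) ?_ ?_ ?_ ?_
  · obtain ⟨X, hX⟩ := key
    exact ⟨X, Set.mem_iInter.1 hX⟩
  · intro k X hX r hr
    obtain ⟨s, hs⟩ := exists_isCode (pre X (k + 1))
    refine hT.of_prefix s (hX s hs) r (by rwa [hr.1.2]) ?_
    rw [hr.1.2, hs.1.2]
    exact pre_prefix X (Nat.le_succ k)
  · intro k
    -- Codes determine their strings and vice versa, so only finitely many members of `T` have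
    -- length below `k`. A longer member, padded by `false`, then lies in the `k`-th class.
    have hfin : {s ∈ T | (stringOf s).length < k}.Finite := by
      refine Set.Finite.of_finite_image (f := stringOf)
        ((List.finite_length_lt Bool k).subset ?_) fun s hs t ht h => ?_
      · rintro _ ⟨s, hs, rfl⟩
        exact hs.2
      · exact (hT.isCode s hs.1).unique (h ▸ hT.isCode t ht.1)
    obtain ⟨t, ht, hk⟩ := hT.infinite.exists_notMem_finite hfin
    have hk : k ≤ (stringOf t).length := not_lt.1 fun h => hk ⟨ht, h⟩
    refine ⟨fun i => (stringOf t).getD i false, fun s hs => ?_⟩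
    refine hT.of_prefix t ht s (by rwa [hs.1.2]) ?_
    rw [hs.1.2]
    conv_rhs => rw [← pre_getD (stringOf t)]
    exact pre_prefix _ hk
  · exact (isClopen_setOf_pre (fun ρ => ∀ s, IsCode s ρ → s ∈ T) 0).isClosed.isCompact
  · exact fun k => (isClopen_setOf_pre (fun ρ => ∀ s, IsCode s ρ → s ∈ T) k).isClosed

/-- A sequence fails to be a path as soon as one of its prefixes has a code outside `T`, so the
paths form a `Π⁰₁` class. -/
theorem sig_paths {f : ℕ → ℕ} {T : Set ℕ} (hT : SigmaIn f (· ∉ T)) :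
    Sig (join f) fun X (_ : Unit) => ∃ k s, IsCode s (pre X k) ∧ s ∉ T := by
  have h₁ : Sig (join f) fun _ (q : (Unit × ℕ) × ℕ) => q.2 ∉ T :=
    (hT.reindex (o' := join f) (fun _ => ()) (Primrec.fst.comp .unpair) fun X n => by
      simp [join]).comp .snd
  have hg : Primrec fun n : ℕ => n.unpair.2 == 1 :=
    Primrec.beq.comp (Primrec.snd.comp .unpair) (.const 1)
  have h₂ : Sig (join f) fun X (q : (Unit × ℕ) × ℕ) => IsCode q.2 (pre X q.1.2) := by
    refine (Sig.oracle (p := fun q : ((Unit × ℕ) × ℕ) × List ℕ =>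
      IsCode q.1.2 (q.2.map fun n => n.unpair.2 == 1)) (b := fun q => q.1.2)
      ?_ (Primrec.snd.comp .fst)).congr fun X q => ?_
    · exact primrecRel_isCode.comp (Primrec.snd.comp .fst)
        (Primrec.list_map .snd (hg.comp Primrec.snd).to₂)
    · rw [map_pre]
      have : (fun n => (join f X n).unpair.2 == 1) = X := by
        funext n
        cases h : X n <;> simp [join, h]
      rw [this]
  exact ((h₂.and h₁).ex).ex

theorem decides_join (f : ℕ → ℕ) (X : ℕ → Bool) : Decides (join f X) {i | X i = true} := by
  have hp : PrimrecPred fun q : ℕ × List ℕ => (q.2.getD q.1 0).unpair.2 = 1 :=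
    Primrec.eq.comp (Primrec.snd.comp (Primrec.unpair.comp
      ((Primrec.list_getD 0).comp .snd .fst))) (.const 1)
  have e (n : ℕ) : X n = true ↔ ((pre (join f X) (n + 1)).getD n 0).unpair.2 = 1 := by
    cases h : X n <;> simp [List.getD_eq_getElem?_getD, join, h]
  exact ⟨(Sig.oracle hp .succ).congr fun _ n => e n,
    (Sig.oracle hp.not .succ).congr fun _ n => not_congr (e n)⟩

/-- Every noncomputable set is omitted by an `ω`-model of weak König's lemma. -/
theorem exists_scott_model {B : Set ℕ} (hB : ¬ Decides (fun _ => 0) B) :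
    ∃ f, IsTower f ∧ Holds (towerSets f) WKL ∧ B ∉ towerSets f := by
  have key : ∀ C : ℕ → Prop, ¬ SigmaIn (fun _ => 0) C → ∃ f, IsTower f ∧
      Holds (towerSets f) WKL ∧ ∀ i, ¬ SigmaIn (f i) C := by
    intro C hC
    obtain ⟨f, hf, hfC, hpath⟩ := exists_tower_avoiding hC
    refine ⟨f, hf, holds_WKL.2 ?_, hfC⟩
    rintro T ⟨j, hj⟩ hT
    obtain ⟨X, hX⟩ := hT.exists_path
    obtain ⟨Y, hY, i, hi⟩ := hpath j _ (sig_paths hj.2)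
      ⟨X, fun ⟨k, s, hs, hsT⟩ => hsT (hX k s hs)⟩
    refine ⟨Y, ⟨i + 1, hi ▸ decides_join _ Y⟩, fun k => ?_⟩
    obtain ⟨s, hs⟩ := exists_isCode (pre Y k)
    exact ⟨s, by_contra fun hsT => hY ⟨k, s, hs, hsT⟩, hs.1.2⟩
  -- `B` or its complement is not `Σ⁰₁`; keeping that one from becoming `Σ⁰₁` keeps `B` out of the
  -- model.
  rw [Decides, not_and_or] at hB
  rcases hB with hB | hB
  · obtain ⟨f, hf, hW, h⟩ := key _ hB
    exact ⟨f, hf, hW, fun ⟨i, hi⟩ => h i hi.1⟩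
  · obtain ⟨f, hf, hW, h⟩ := key _ hB
    exact ⟨f, hf, hW, fun ⟨i, hi⟩ => h i hi.2⟩

/-! ### The computable sets -/

theorem isTower_zero : IsTower fun _ _ => 0 := fun _ _ => by simp

theorem mem_towerSets_zero {X : Set ℕ} :
    X ∈ towerSets (fun _ _ => 0) ↔ Decides (fun _ => 0) X := by simp [towerSets]

theorem towerSets_zero_subset (f : ℕ → ℕ → ℕ) : towerSets (fun _ _ => 0) ⊆ towerSets f := by
  rintro X ⟨_, h⟩
  exact ⟨0, h.1.reindex id (.const 0) fun _ _ => rfl, h.2.reindex id (.const 0) fun _ _ => rfl⟩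

/-- With the zero oracle, acceptance is an unbounded search for a primitive recursive stage. -/
theorem SigmaIn.rePred {S : ℕ → Prop} (h : SigmaIn (fun _ => 0) S) : REPred S := by
  classical
  obtain ⟨R, ⟨_, hR⟩, -, hS⟩ := h
  have hp : Primrec₂ fun n k : ℕ => decide (R n (pre (fun _ => 0) k)) :=
    (hR.comp (Primrec.fst.pair (Primrec.list_map (Primrec.list_range.comp .snd)
      (Primrec.const 0).to₂))).of_eq fun _ => by simp [pre]
  refine (Partrec.rfind hp.to_comp.partrec₂).dom_re.of_eq fun n => ?_
  simp [Nat.rfind_dom, hS ()]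

theorem Decides.computable {X : ℕ → Bool} (h : Decides (fun _ => 0) {i | X i = true}) :
    Computable X := by
  have := (ComputablePred.computable_iff_re_compl_re (p := fun i => X i = true)).2
    ⟨SigmaIn.rePred h.1, SigmaIn.rePred h.2⟩
  obtain ⟨_, h⟩ := this
  exact h.of_eq fun n => by simp

open Nat.Partrec in
/-- `σ` differs from the diagonal of the partial recursive functions, as far as can be seen after
`σ.length` steps. -/
def AvoidsDiagonal (σ : List Bool) : Prop :=
  ∀ e < σ.length, Code.evaln σ.length (Denumerable.ofNat Code e) e ≠
    some (σ.getD e false).toNat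

open Nat.Partrec in
theorem primrecPred_avoidsDiagonal : PrimrecPred AvoidsDiagonal := by
  refine primrecPred_forall_lt (p := fun q : List Bool × ℕ =>
    Code.evaln q.1.length (Denumerable.ofNat Code q.2) q.2 ≠ some (q.1.getD q.2 false).toNat)
    (PrimrecPred.not (Primrec.eq.comp ?_ ?_)) Primrec.list_length
  · exact Code.primrec_evaln.comp (((Primrec.list_length.comp .fst).pair
      ((Primrec.ofNat Code).comp .snd)).pair .snd)
  · exact Primrec.option_some.comp ((Primrec.dom_bool Bool.toNat).comp
      ((Primrec.list_getD false).comp .fst .snd))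

theorem AvoidsDiagonal.of_prefix {σ τ : List Bool} (h : AvoidsDiagonal τ) (hst : σ <+: τ) :
    AvoidsDiagonal σ := by
  intro e he hev
  refine h e (he.trans_le hst.length_le) ?_
  have : τ.getD e false = σ.getD e false := by
    obtain ⟨ρ, rfl⟩ := hst
    simp [List.getD_eq_getElem?_getD, List.getElem?_append_left he]
  rw [this]
  exact Nat.Partrec.Code.evaln_mono hst.length_le hev

theorem exists_avoidsDiagonal (k : ℕ) : ∃ σ, AvoidsDiagonal σ ∧ σ.length = k := by
  -- The entry is `1` exactly when the computation has returned `0` within `k` steps, so it never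
  -- equals the output.
  refine ⟨pre (fun e => Nat.Partrec.Code.evaln k (Denumerable.ofNat _ e) e == some 0) k,
    fun e he h => ?_, by simp⟩
  rw [length_pre] at he h
  simp only [List.getD_eq_getElem?_getD, getElem?_pre, he, if_true, Option.getD_some] at h
  cases hb : Nat.Partrec.Code.evaln k (Denumerable.ofNat _ e) e == some 0 <;> simp_all

/-- The set of the codes of the strings that avoid the diagonal. -/
def diagonalTree : Set ℕ := {s | IsCode s (stringOf s) ∧ AvoidsDiagonal (stringOf s)}

theorem isInfiniteTree_diagonalTree : IsInfiniteTree diagonalTree where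
  isCode _ hs := hs.1
  of_prefix _ ht _ hs hst := ⟨hs, ht.2.of_prefix hst⟩
  infinite := by
    refine Set.Infinite.of_image (fun s => (stringOf s).length) ?_
    convert Set.infinite_univ (α := ℕ)
    refine Set.eq_univ_of_forall fun k => ?_
    obtain ⟨σ, hσ, hk⟩ := exists_avoidsDiagonal k
    obtain ⟨s, hs⟩ := exists_isCode σ
    have hσs := hs.1.2
    subst hσs
    exact ⟨s, ⟨hs, hσ⟩, hk⟩

theorem decides_diagonalTree (f : ℕ → ℕ) : Decides f diagonalTree :=
  decides_of_primrecPred ((primrecRel_isCode.comp .id primrec_stringOf).and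
    (primrecPred_avoidsDiagonal.comp primrec_stringOf))

/-- A computable path would be computed by some code, and would agree with the diagonal at the index
of that code. -/
theorem not_computable_of_isPathThrough {X : ℕ → Bool} (h : IsPathThrough diagonalTree X) :
    ¬ Computable X := by
  intro hX
  have hc : Computable fun n => (X n).toNat := (Primrec.dom_bool Bool.toNat).to_comp.comp hX
  obtain ⟨c, hc⟩ := Nat.Partrec.Code.exists_code.1 (Partrec.nat_iff.1 hc.partrec)
  set e := Encodable.encode c with he
  have hev : (X e).toNat ∈ c.eval e := by rw [hc]; simp
  obtain ⟨k, hk⟩ := Nat.Partrec.Code.evaln_complete.1 hev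
  -- The prefix must be long enough both to contain position `e` and to allow the `k` steps of the
  -- computation.
  obtain ⟨s, hs, hsX⟩ := h (max k (e + 1))
  refine hs.2 e (by rw [hsX, length_pre]; omega) ?_
  rw [hsX, length_pre, he, Denumerable.ofNat_encode, ← he]
  have : (pre X (max k (e + 1))).getD e false = X e := by
    simp [List.getD_eq_getElem?_getD]
  rw [this]
  exact Nat.Partrec.Code.evaln_mono (le_max_left _ _) hk

theorem not_holds_WKL_computable : ¬ Holds (towerSets fun _ _ => 0) WKL := by
  intro h
  obtain ⟨X, hX, hpath⟩ := holds_WKL.1 h diagonalTree ⟨0, decides_diagonalTree _⟩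
    isInfiniteTree_diagonalTree
  exact not_computable_of_isPathThrough hpath (mem_towerSets_zero.1 hX).computable

/-- An instance of arithmetical comprehension that holds in every `ω`-model of weak König's lemma
holds in the `ω`-model of the computable sets. -/
theorem holds_computable_of_derives_WKL {σ : Sentence} (hσ : σ ∈ arithmeticalComprehension)
    (h : Derives (RCA₀ ∪ {WKL}) σ) : Holds (towerSets fun _ _ => 0) σ := by
  obtain ⟨n, m, φ, hφ, rfl⟩ := hσ
  refine (holds_closure _).2 fun v V hV => ?_
  rw [sat_comprehensionFor, mem_towerSets_zero]
  by_contra hB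
  obtain ⟨f, hf, hW, hfB⟩ := exists_scott_model hB
  have hf' : (towerSets f).Nonempty :=
    ⟨_, towerSets_zero_subset f (mem_towerSets_zero.2 (decides_diagonalTree _))⟩
  have := h.holds hf' fun γ hγ => hγ.elim hf.holds_RCA₀ (by rintro rfl; exact hW)
  have := (sat_comprehensionFor φ v V).1
    ((holds_closure _).1 this v V fun i => towerSets_zero_subset f (hV i))
  refine hfB ?_
  -- By absoluteness, the set that comprehension yields in the omitting model is the one defined in
  -- the computable model.
  simpa only [hφ.sat_iff (M := towerSets fun _ _ => 0) (N := towerSets f)] using this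

end SecondOrderArithmetic

open SecondOrderArithmetic in
theorem theorem1 (S : Set Sentence) (hS : S ⊆ arithmeticalComprehension) :
    ¬ EquivalentOver RCA₀ S {WKL} := by
  rintro ⟨h₁, h₂⟩
  refine not_holds_WKL_computable ((h₁ WKL rfl).holds
    ⟨_, mem_towerSets_zero.2 (decides_diagonalTree _)⟩ fun γ hγ => ?_)
  rcases hγ with hγ | hγ
  · exact isTower_zero.holds_RCA₀ hγ
  · exact holds_computable_of_derives_WKL (hS hγ) (h₂ γ hγ)
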